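/- **Setting.** Let $N\ge 1$, $k\in\mathbb N$. Write $X=(x,y)\in\mathbb R^N\times\mathbb R$, $\mathbb R^{N+1}_+=\{y>0\}$, $D^+=D\cap\{y>0\}$ for $D\subset\mathbb R^{N+1}$, $B_r^+(x_0,0)=B_r(x_0,0)\cap\{y>0\}$ and $\partial^+B_r^+=\partial B_r\cap\{y>0\}$. A segregation entire profile (an element of the class $\mathcal G_s$) is a $k$-tuple $\mathbf v=(v_1,\dots,v_k)$ of functions, continuous on $\overline{\mathbb R^{N+1}_+}$, with $v_i\in H^1(D^+)$ for every bounded open $D\subset\mathbb R^{N+1}$, such that 1. $v_iv_j=0$ on $\{y=0\}$ for $i\ne j$; 2. for every $i$, $-\Delta v_i=0$ in $\mathbb R^{N+1}_+$ and $v_i\,\partial_\nu v_i=0$ on $\mathbb R^N\times\{0\}$ in the weak sense, i.e. $\int_{\mathbb R^{N+1}_+}\nabla v_i\cdot\nabla(v_i\varphi)\,dx\,dy=0$ for every $\varphi\in C_c^\infty(\mathbb R^{N+1})$; 3. for every $0\le h\le N$, every orthogonal decomposition $\mathbb R^{N+1}_+=\mathbb R^{h+1}_+\oplus\mathbb R^{N-h}$,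 $X=(x',x'',y)$ with $(x',y)\in\mathbb R^{h+1}_+$, $x''\in\mathbb R^{N-h}$ (with any choice of orthonormal coordinates $x''$), every $x_0\in\mathbb R^N$ and a.e. $r,l>0$, writing $C_{r,l}^+=B_r^+(x_0',0)\times Q_l(x_0'')$ with $B_r^+\subset\mathbb R^{h+1}_+$ a half ball of radius $r$ and $Q_l\subset\mathbb R^{N-h}$ a cube of edge length $2l$, $$\int_{C_{r,l}^+}\sum_i\Big(2|\nabla_{(x',y)}v_i|^2-(h+1)|\nabla v_i|^2\Big)dx\,dy+r\int_{\partial^+B_r^+\times Q_l}\sum_i|\nabla v_i|^2d\sigma$$ $$=2r\int_{\partial^+B_r^+\times Q_l}\sum_i|\partial_\nu v_i|^2d\sigma+2\int_{B_r^+\times\partial Q_l}\sum_i\partial_\nu v_i\,\nabla_{(x',y)}v_i\cdot(x'-x_0',y)\,d\sigma .$$ For $x_0\in\mathbb R^N$, $r>0$ put $$E(x_0,r)=\frac1{r^{N-1}}\int_{B_r^+(x_0,0)}\sum_i|\nabla v_i|^2\,dx\,dy,\qquad H(x_0,r)=\frac1{r^N}\int_{\partial^+B_r^+(x_0,0)}\sum_iv_i^2\,d\sigma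 .$$ **Theorem.** Let $\mathbf v\in\mathcal G_s$, $\mathbf v\not\equiv0$. For every $x_0\in\mathbb R^N$ the frequency $N(x_0,r)=E(x_0,r)/H(x_0,r)$ is well defined for all $r>0$ (that is, $E(x_0,r)<\infty$ and $H(x_0,r)>0$), is locally absolutely continuous on $(0,\infty)$ (absolutely continuous on every compact subinterval), is nondecreasing, and $$\frac{d}{dr}\log H(x_0,r)=\frac{2N(x_0,r)}{r}\qquad\text{for every } r>0 .$$ Moreover, if $N(x_0,r)=\gamma$ for all $r$ in some nonempty open interval contained in $(0,\infty)$, then $N(x_0,r)=\gamma$ for every $r>0$, and $\mathbf v$ is homogeneous of degree $\gamma$ with respect to $(x_0,0)$: $\mathbf v\big((x_0,0)+t\,\xi\big)=t^\gamma\,\mathbf v\big((x_0,0)+\xi\big)$ for all $t>0$ and all $\xi\in\overline{\mathbb R^{N+1}_+}$. -/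

import Mathlib

open MeasureTheory Set
open scoped ContDiff

noncomputable section

/-- The Euclidean space `ℝⁿ`. A point of `ℝ^{n+1}` is written `X = (x, y)`, where `y` is its last
coordinate. -/
abbrev Euc (n : ℕ) : Type := EuclideanSpace ℝ (Fin n)

/-- The open half space `{(x, y) ∈ ℝ^{n+1} : y > 0}`. -/
def upperHalf (n : ℕ) : Set (Euc (n + 1)) := {X | 0 < X (Fin.last n)}

/-- The closed half space `{(x, y) ∈ ℝ^{n+1} : y ≥ 0}`. -/
def closedUpperHalf (n : ℕ) : Set (Euc (n + 1)) := {X | 0 ≤ X (Fin.last n)}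

/-- The boundary point `(x₀, 0) ∈ ℝ^{n+1}` for `x₀ ∈ ℝⁿ`. -/
def bdryPt {n : ℕ} (x₀ : Euc n) : Euc (n + 1) :=
  WithLp.toLp 2 (Fin.snoc (α := fun _ => ℝ) (fun j => x₀ j) 0)

/-- The half ball `B_r⁺(X₀) = B_r(X₀) ∩ {y > 0}`. -/
def halfBall (n : ℕ) (X₀ : Euc (n + 1)) (r : ℝ) : Set (Euc (n + 1)) :=
  Metric.ball X₀ r ∩ upperHalf n

/-- The open cube of edge length `2l` centred at the origin of `ℝᵐ`. -/
def cube (m : ℕ) (l : ℝ) : Set (Euc m) := {η | ∀ j, |η j| < l}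

/-! ### Sobolev spaces -/

/-- `G` is the weak (distributional) gradient of `u` on the open set `Ω`. -/
def HasWeakGradientOn {n : ℕ} (u : Euc n → ℝ) (G : Euc n → Euc n) (Ω : Set (Euc n)) : Prop :=
  ∀ φ : Euc n → ℝ, ContDiff ℝ ∞ φ → HasCompactSupport φ → tsupport φ ⊆ Ω →
    ∫ X in Ω, u X • gradient φ X = -∫ X in Ω, φ X • G X

/-- `u ∈ H¹(Ω)`: `u` is in `L²(Ω)` and has a weak gradient in `L²(Ω)`. -/
def MemH1 {n : ℕ} (u : Euc n → ℝ) (Ω : Set (Euc n)) : Prop :=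
  MemLp u 2 (volume.restrict Ω) ∧
    ∃ G : Euc n → Euc n, MemLp G 2 (volume.restrict Ω) ∧ HasWeakGradientOn u G Ω

/-- `u ∈ H¹_loc` of the closed half space: `u` is in `H¹(D ∩ {y > 0})` for every bounded open
`D ⊆ ℝ^{n+1}`. -/
def MemH1LocClosedHalf {n : ℕ} (u : Euc (n + 1) → ℝ) : Prop :=
  ∀ D : Set (Euc (n + 1)), IsOpen D → Bornology.IsBounded D → MemH1 u (D ∩ upperHalf n)

/-! ### Surface integrals -/

/-- The integral of `F` over the half sphere `∂⁺B_r⁺(0) = {ξ ∈ ℝ^{n+1} : |ξ| = r, y > 0}` with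
respect to the `n`-dimensional surface measure, which is the image under `θ ↦ r θ` of `rⁿ` times
the surface measure of the unit sphere. -/
def halfSphereIntegral (n : ℕ) (r : ℝ) (F : Euc (n + 1) → ℝ) : ℝ :=
  r ^ n * ∫ θ in {θ : Metric.sphere (0 : Euc (n + 1)) 1 | (θ : Euc (n + 1)) ∈ upperHalf n},
    F (r • (θ : Euc (n + 1))) ∂(volume : Measure (Euc (n + 1))).toSphere

/-- The point of `ℝᵐ` whose `j`-th coordinate is `c` and whose other coordinates are given
by `ζ`. -/
def facePt {m : ℕ} (j : Fin m) (c : ℝ) (ζ : {i : Fin m // i ≠ j} → ℝ) : Euc m :=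
  WithLp.toLp 2 (fun i => if hi : i = j then c else ζ ⟨i, hi⟩)

/-- The integral of `F` over the face `{η : η_j = s l, |η_i| < l for i ≠ j}` of the cube of edge
length `2l` in `ℝᵐ` (`s = 1` or `s = -1`), with respect to the `(m-1)`-dimensional measure. -/
def cubeFaceIntegral {m : ℕ} (l : ℝ) (j : Fin m) (s : ℝ) (F : Euc m → ℝ) : ℝ :=
  ∫ ζ in {ζ : {i : Fin m // i ≠ j} → ℝ | ∀ i, |ζ i| < l}, F (facePt j (s * l) ζ)

/-! ### Cylinders and the Pohozaev identity -/

/-- An orthogonal decomposition of the half space `ℝ^{N+1}_+ = ℝ^{h+1}_+ ⊕ ℝ^m`, given as a linear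
isometry `((x', y), x'') ↦ (x, y)` which keeps the coordinate `y`. It also fixes the orthonormal
coordinates `x''` in which the cubes of the second summand are taken. -/
def IsHalfSpaceSplitting {N h m : ℕ} (Φ : WithLp 2 (Euc (h + 1) × Euc m) ≃ₗᵢ[ℝ] Euc (N + 1)) :
    Prop :=
  ∀ p : WithLp 2 (Euc (h + 1) × Euc m), (Φ p) (Fin.last N) = p.fst (Fin.last h)

section Cylinder

variable {N h m : ℕ} (Φ : WithLp 2 (Euc (h + 1) × Euc m) ≃ₗᵢ[ℝ] Euc (N + 1))

/-- The point with coordinates `(x' - x₀', y) = ξ`, `x'' - x₀'' = η` relative to `X₀`. -/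
def splitPt (X₀ : Euc (N + 1)) (ξ : Euc (h + 1)) (η : Euc m) : Euc (N + 1) :=
  X₀ + Φ (WithLp.toLp 2 (ξ, η))

/-- The cylinder `C_{r,l}⁺ = B_r⁺ × Q_l` centred at `X₀`. -/
def halfCylinder (X₀ : Euc (N + 1)) (r l : ℝ) : Set (Euc (N + 1)) :=
  {X | (Φ.symm (X - X₀)).fst ∈ halfBall h 0 r ∧ (Φ.symm (X - X₀)).snd ∈ cube m l}

/-- The partial gradient `∇_{(x', y)} u`. -/
def gradFst (u : Euc (N + 1) → ℝ) (X : Euc (N + 1)) : Euc (h + 1) :=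
  (Φ.symm (gradient u X)).fst

/-- The partial gradient `∇_{x''} u`. -/
def gradSnd (u : Euc (N + 1) → ℝ) (X : Euc (N + 1)) : Euc m :=
  (Φ.symm (gradient u X)).snd

/-- The Pohozaev identity for `v` on the cylinder `C_{r,l}⁺` centred at `X₀`:
`∫_C ∑ᵢ (2|∇_{(x',y)} vᵢ|² - (h+1)|∇vᵢ|²) + r ∫_{∂⁺B_r⁺ × Q_l} ∑ᵢ |∇vᵢ|²`
`= 2r ∫_{∂⁺B_r⁺ × Q_l} ∑ᵢ |∂_ν vᵢ|²`
`+ 2 ∫_{B_r⁺ × ∂Q_l} ∑ᵢ ∂_ν vᵢ ∇_{(x',y)} vᵢ · (x' - x₀', y)`.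
The outer normal is `(ξ / r, 0)` on `∂⁺B_r⁺ × Q_l`, and `(0, s e_j)` on `B_r⁺` times the face
`η_j = s l` of the cube. If the gradients are square integrable on bounded parts of the half space,
then all the integrals converge for almost every `(r, l)`. -/
def PohozaevOn {k : ℕ} (v : Fin k → Euc (N + 1) → ℝ) (X₀ : Euc (N + 1)) (r l : ℝ) : Prop :=
  (∫ X in halfCylinder Φ X₀ r l,
      ∑ i, (2 * ‖gradFst Φ (v i) X‖ ^ 2 - ((h : ℝ) + 1) * ‖gradient (v i) X‖ ^ 2)) +
    r * halfSphereIntegral h r (fun ξ => ∫ η in cube m l,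
      ∑ i, ‖gradient (v i) (splitPt Φ X₀ ξ η)‖ ^ 2) =
  2 * r * halfSphereIntegral h r (fun ξ => ∫ η in cube m l,
      ∑ i, (inner ℝ (gradFst Φ (v i) (splitPt Φ X₀ ξ η)) (r⁻¹ • ξ)) ^ 2) +
    2 * ∑ j : Fin m, ∑ s ∈ ({1, -1} : Finset ℝ), ∫ ξ in halfBall h 0 r,
      cubeFaceIntegral l j s (fun η =>
        ∑ i, (s * gradSnd Φ (v i) (splitPt Φ X₀ ξ η) j) *
          inner ℝ (gradFst Φ (v i) (splitPt Φ X₀ ξ η)) ξ)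

end Cylinder

/-! ### Segregation entire profiles -/

/-- The class `𝒢_s` of segregation entire profiles `v = (v₁, …, v_k)` on the closed half space
of `ℝ^{N+1}`. Only the values of `v` on `{y ≥ 0}` matter. -/
structure IsSegregationProfile {N k : ℕ} (v : Fin k → Euc (N + 1) → ℝ) : Prop where
  memH1Loc : ∀ i, MemH1LocClosedHalf (v i)
  continuousOn : ∀ i, ContinuousOn (v i) (closedUpperHalf N)
  /-- `vᵢ vⱼ = 0` on `{y = 0}` for `i ≠ j`. -/
  segregated : ∀ i j, i ≠ j → ∀ X : Euc (N + 1), X (Fin.last N) = 0 → v i X * v j X = 0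
  /-- `-Δvᵢ = 0` in `{y > 0}`. -/
  harmonic : ∀ i, InnerProductSpace.HarmonicOnNhd (v i) (upperHalf N)
  /-- `vᵢ ∂_ν vᵢ = 0` on `{y = 0}` in the weak sense: for harmonic `vᵢ`,
  `∫_{y = 0} vᵢ (∂_ν vᵢ) φ` is `∫_{y > 0} ∇vᵢ · ∇(vᵢ φ)`. -/
  boundary : ∀ i, ∀ φ : Euc (N + 1) → ℝ, ContDiff ℝ ∞ φ → HasCompactSupport φ →
    ∫ X in upperHalf N, (inner ℝ (gradient (v i) X) (gradient (fun Z => v i Z * φ Z) X) : ℝ) = 0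
  /-- The Pohozaev identity on cylinders centred at `(x₀, 0)`, for all decompositions and
  a.e. `(r, l)`. -/
  pohozaev : ∀ h m : ℕ, h + m = N →
    ∀ Φ : WithLp 2 (Euc (h + 1) × Euc m) ≃ₗᵢ[ℝ] Euc (N + 1), IsHalfSpaceSplitting Φ →
    ∀ x₀ : Euc N, ∀ᵐ p : ℝ × ℝ, 0 < p.1 → 0 < p.2 → PohozaevOn Φ v (bdryPt x₀) p.1 p.2

/-! ### The Almgren frequency -/

/-- `E(x₀, r) = r^{-(N-1)} ∫_{B_r⁺(x₀,0)} ∑ᵢ |∇vᵢ|²` (for `N ≥ 1`). -/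
def almgrenE {N k : ℕ} (v : Fin k → Euc (N + 1) → ℝ) (x₀ : Euc N) (r : ℝ) : ℝ :=
  1 / r ^ (N - 1) * ∫ X in halfBall N (bdryPt x₀) r, ∑ i, ‖gradient (v i) X‖ ^ 2

/-- `H(x₀, r) = r^{-N} ∫_{∂⁺B_r⁺(x₀,0)} ∑ᵢ vᵢ²`. -/
def almgrenH {N k : ℕ} (v : Fin k → Euc (N + 1) → ℝ) (x₀ : Euc N) (r : ℝ) : ℝ :=
  1 / r ^ N * halfSphereIntegral N r (fun ξ => ∑ i, (v i (bdryPt x₀ + ξ)) ^ 2)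

/-- The Almgren frequency `N(x₀, r) = E(x₀, r) / H(x₀, r)`. -/
def almgrenN {N k : ℕ} (v : Fin k → Euc (N + 1) → ℝ) (x₀ : Euc N) (r : ℝ) : ℝ :=
  almgrenE v x₀ r / almgrenH v x₀ r

end

/-! Write `A` for the Dirichlet energy of the half ball, `a` for its density on the half sphere, `B`
for the integral of `(∂_ν v)²` there. Two identities drive the proof. Testing `vᵢ ∂_ν vᵢ = 0` with
radial functions gives `A r = ∫ v ∂_ν v` over the half sphere (`ae_energy_eq_flux`), hence `H' = 2A
/ r^N`. The Pohozaev identity with `h = N` reads `(1 - N) A + r a = 2 r B`. Differentiating `A r · r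
/ (r^N H)` and eliminating `a` leaves `2r (B r^N H - A²) / (r^N H)²`, which is nonnegative by
Cauchy–Schwarz. The one-variable part of the argument is isolated in `AlmgrenData`. Since flux and
Pohozaev identities hold only for almost every radius, monotonicity goes through absolute
continuity. Positivity of `H` comes from the same computation: a bounded frequency bounds `H' / H`,
so `H` cannot reach zero (`mass_pos`).

For the rigidity, a constant frequency on an interval forces equality in Cauchy–Schwarz there, that
is `∂_r v = (γ / r) v`, and integration along rays makes `v` homogeneous in a half annulus
(`homogeneous_annulus`). For `s` slightly above `1` the function `v(sX) - s^γ v(X)` is harmonic in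
the half space and vanishes on an open set, so it vanishes identically; products of such `s` and
inverses give all dilations (`homogeneous`).

Unique continuation is derived from Green's identity. Applied to two dilates of `u`, it shows that
`∫ u(m eᵗ θ) u(m e⁻ᵗ θ) dθ` does not depend on `t`. If `u` vanishes near the centre, a large `t`
makes this integral zero, and `t = 0` then gives `u = 0` on the sphere of radius `m`. -/

noncomputable section

/-! ### Polar coordinates -/

/-- The surface measure of the unit sphere of `ℝ^{n+1}`. -/
abbrev sphereMeasure (n : ℕ) : Measure (Metric.sphere (0 : Euc (n + 1)) 1) :=
  (volume : Measure (Euc (n + 1))).toSphere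

/-- The measure `ρⁿ dρ` on `(0, ∞)`. -/
def radialMeasure (n : ℕ) : Measure ℝ :=
  (volume.restrict (Ioi (0 : ℝ))).withDensity fun ρ => ENNReal.ofReal (ρ ^ n)

/-- `Measure.volumeIoiPow` lives on the subtype `Ioi 0`; moving it to `ℝ` allows radial integrals to
be written as ordinary set integrals. -/
lemma map_val_volumeIoiPow (n : ℕ) :
    (Measure.volumeIoiPow n).map Subtype.val = radialMeasure n := by
  have he : MeasurableEmbedding (Subtype.val : Ioi (0 : ℝ) → ℝ) :=
    MeasurableEmbedding.subtype_coe measurableSet_Ioi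
  have hm : Measurable fun ρ : ℝ => ENNReal.ofReal (ρ ^ n) := by fun_prop
  ext s hs
  rw [radialMeasure, withDensity_apply _ hs, he.map_apply, Measure.volumeIoiPow,
    withDensity_apply _ (he.measurable hs), ← map_comap_subtype_coe measurableSet_Ioi,
    he.restrict_map, he.lintegral_map]

instance (n : ℕ) : SFinite (radialMeasure n) := by
  unfold radialMeasure; infer_instance

lemma measurePreserving_polar (n : ℕ) (p : Euc (n + 1)) :
    MeasurePreserving
      (fun q : ℝ × Metric.sphere (0 : Euc (n + 1)) 1 => p + q.1 • (q.2 : Euc (n + 1)))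
      ((radialMeasure n).prod (sphereMeasure n)) volume := by
  have h1 := (volume : Measure (Euc (n + 1))).measurePreserving_homeomorphUnitSphereProd
  have hdim : Module.finrank ℝ (Euc (n + 1)) - 1 = n := by simp
  rw [hdim] at h1
  have h2 : MeasurePreserving (homeomorphUnitSphereProd (Euc (n + 1))).symm
      ((sphereMeasure n).prod (Measure.volumeIoiPow n)) (volume.comap Subtype.val) :=
    h1.symm (homeomorphUnitSphereProd (Euc (n + 1))).toMeasurableEquiv
  have h3 : MeasurePreserving (Subtype.val : ({0}ᶜ : Set (Euc (n + 1))) → Euc (n + 1))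
      (volume.comap Subtype.val) volume := by
    refine ⟨measurable_subtype_coe, ?_⟩
    rw [map_comap_subtype_coe (measurableSet_singleton _).compl]
    exact restrict_compl_singleton 0
  have h4 := (measurePreserving_add_left (volume : Measure (Euc (n + 1))) p).comp (h3.comp h2)
  have h5 : MeasurePreserving
      (fun q : Metric.sphere (0 : Euc (n + 1)) 1 × ℝ => p + q.2 • (q.1 : Euc (n + 1)))
      ((sphereMeasure n).prod (radialMeasure n)) volume := by
    refine ⟨by fun_prop, ?_⟩
    have h6 : (sphereMeasure n).prod (radialMeasure n) =
        ((sphereMeasure n).prod (Measure.volumeIoiPow n)).map (Prod.map id Subtype.val) := by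
      rw [← map_val_volumeIoiPow, ← Measure.map_prod_map _ _ measurable_id measurable_subtype_coe,
        Measure.map_id]
    rw [h6, Measure.map_map (by fun_prop) (by fun_prop)]
    exact h4.map_eq
  exact h5.comp Measure.measurePreserving_swap

lemma radialMeasure_prod (n : ℕ) :
    (radialMeasure n).prod (sphereMeasure n) =
      ((volume.restrict (Ioi (0 : ℝ))).prod (sphereMeasure n)).withDensity
        fun q => ENNReal.ofReal (q.1 ^ n) :=
  prod_withDensity_left (by fun_prop)

lemma integrable_polar {n : ℕ} (p : Euc (n + 1)) {F : Euc (n + 1) → ℝ} (hF : Integrable F) :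
    Integrable (fun q : ℝ × Metric.sphere (0 : Euc (n + 1)) 1 =>
      q.1 ^ n * F (p + q.1 • (q.2 : Euc (n + 1))))
      ((volume.restrict (Ioi (0 : ℝ))).prod (sphereMeasure n)) := by
  have h1 := (measurePreserving_polar n p).integrable_comp_of_integrable hF
  rw [radialMeasure_prod, integrable_withDensity_iff_integrable_smul' (by fun_prop) (by simp)] at h1
  refine h1.congr ?_
  have h2 : ∀ᵐ q ∂((volume.restrict (Ioi (0 : ℝ))).prod (sphereMeasure n)), 0 < q.1 :=
    Measure.quasiMeasurePreserving_fst.ae (ae_restrict_mem measurableSet_Ioi)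
  filter_upwards [h2] with q hq
  simp [ENNReal.toReal_ofReal (pow_pos hq n).le]

lemma integral_polar {n : ℕ} (p : Euc (n + 1)) {F : Euc (n + 1) → ℝ} (hF : Integrable F) :
    ∫ X, F X = ∫ ρ in Ioi (0 : ℝ), ρ ^ n * ∫ θ, F (p + ρ • (θ : Euc (n + 1))) ∂sphereMeasure n := by
  have hmp := measurePreserving_polar n p
  rw [← hmp.map_eq, integral_map hmp.measurable.aemeasurable
    (by rw [hmp.map_eq]; exact hF.aestronglyMeasurable), radialMeasure_prod,
    integral_withDensity_eq_integral_toReal_smul (by fun_prop) (by simp)]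
  have h3 : ∫ q, (ENNReal.ofReal (q.1 ^ n)).toReal • F (p + q.1 • (q.2 : Euc (n + 1)))
        ∂((volume.restrict (Ioi (0 : ℝ))).prod (sphereMeasure n)) =
      ∫ q, q.1 ^ n * F (p + q.1 • (q.2 : Euc (n + 1)))
        ∂((volume.restrict (Ioi (0 : ℝ))).prod (sphereMeasure n)) := by
    refine integral_congr_ae ?_
    have h2 : ∀ᵐ q ∂((volume.restrict (Ioi (0 : ℝ))).prod (sphereMeasure n)), 0 < q.1 :=
      Measure.quasiMeasurePreserving_fst.ae (ae_restrict_mem measurableSet_Ioi)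
    filter_upwards [h2] with q hq
    simp [ENNReal.toReal_ofReal (pow_pos hq n).le]
  rw [h3, integral_prod _ (integrable_polar p hF)]
  simp_rw [integral_const_mul]

/-! ### Radial test functions and the flux through spheres -/

lemma IsCompact.exists_Icc_of_subset_Ioo {K : Set ℝ} (hK : IsCompact K) {c d : ℝ} (hcd : c < d)
    (h : K ⊆ Ioo c d) : ∃ a b, c < a ∧ b < d ∧ K ⊆ Icc a b := by
  rcases K.eq_empty_or_nonempty with rfl | hne
  · exact ⟨(c + d) / 2, (c + d) / 2, by linarith, by linarith, empty_subset _⟩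
  · obtain ⟨a, ha, ha'⟩ := hK.exists_isLeast hne
    obtain ⟨b, hb, hb'⟩ := hK.exists_isGreatest hne
    exact ⟨a, b, (h ha).1, (h hb).2, fun x hx => ⟨ha' hx, hb' hx⟩⟩

lemma hasDerivAt_integral_Ioi {ψ : ℝ → ℝ} (hψ : Continuous ψ) (hi : Integrable ψ) (t : ℝ) :
    HasDerivAt (fun t => ∫ s in Ioi t, ψ s) (-ψ t) t := by
  have h : (fun t => ∫ s in Ioi t, ψ s) = fun t => (∫ s in Ioi 0, ψ s) - ∫ s in (0 : ℝ)..t, ψ s := by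
    ext t
    rw [← intervalIntegral.integral_Ioi_sub_Ioi' hi.integrableOn hi.integrableOn]
    ring
  rw [h]
  exact (hψ.integral_hasStrictDerivAt 0 t).hasDerivAt.const_sub _

/-- Radial test functions are built from their derivative: `φ` is the tail integral of `ψ` evaluated
at the distance to `p`. Integrating against `φ` then averages ball integrals with weight `ψ`, and
integrating against `∇φ` averages fluxes with the same weight. -/
lemma exists_radial_test {n : ℕ} (p : Euc n) {R : ℝ} (hR : 0 < R) {ψ : ℝ → ℝ}
    (hψ : ContDiff ℝ ∞ ψ) (hc : HasCompactSupport ψ) (hs : tsupport ψ ⊆ Ioo 0 R) :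
    ∃ φ : Euc n → ℝ, ContDiff ℝ ∞ φ ∧ HasCompactSupport φ ∧ tsupport φ ⊆ Metric.ball p R ∧
      (∀ X, φ X = ∫ s in Ioi ‖X - p‖, ψ s) ∧
      ∀ X, gradient φ X = -(ψ ‖X - p‖ • ‖X - p‖⁻¹ • (X - p)) := by
  obtain ⟨a, b, ha, hb, hab⟩ := hc.isCompact.exists_Icc_of_subset_Ioo hR hs
  have hψ0 : ∀ s, s ∉ Icc a b → ψ s = 0 := fun s hs' =>
    image_eq_zero_of_notMem_tsupport fun h => hs' (hab h)
  have hi : Integrable ψ := hψ.continuous.integrable_of_hasCompactSupport hc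
  set η : ℝ → ℝ := fun t => ∫ s in Ioi t, ψ s with hη
  have hηd : ∀ t, HasDerivAt η (-ψ t) t := hasDerivAt_integral_Ioi hψ.continuous hi
  have hηc : ContDiff ℝ ∞ η := by
    rw [contDiff_infty_iff_deriv]
    refine ⟨fun t => (hηd t).differentiableAt, ?_⟩
    rw [show deriv η = fun t => -ψ t from funext fun t => (hηd t).deriv]
    exact hψ.neg
  have hη0 : ∀ t, b ≤ t → η t = 0 := by
    intro t ht
    refine setIntegral_eq_zero_of_forall_eq_zero fun s (hs' : t < s) => hψ0 s ?_
    simp only [mem_Icc, not_and, not_le]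
    intro; linarith
  have hηa : ∀ t, t < a → η t = η 0 := by
    intro t ht
    have h1 := intervalIntegral.integral_Ioi_sub_Ioi' (a := t) (b := 0) hi.integrableOn
      hi.integrableOn
    have h2 : ∫ s in t..0, ψ s = 0 := by
      refine intervalIntegral.integral_zero_ae (Filter.Eventually.of_forall fun s hs' => hψ0 s ?_)
      rcases mem_uIoc.1 hs' with h | h <;> simp only [mem_Icc, not_and, not_le] <;> intro <;>
        linarith [h.1, h.2]
    linarith
  -- The support of `ψ` stays away from `0`, so `φ` is constant near `p`, where the norm is not
  -- smooth.
  have hnear : ∀ X, X ∈ Metric.ball p a → (fun X => η ‖X - p‖) =ᶠ[nhds X] fun _ => η 0 := by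
    intro X hX
    filter_upwards [Metric.isOpen_ball.mem_nhds hX] with Y hY
    exact hηa _ (by simpa [dist_eq_norm] using hY)
  refine ⟨fun X => η ‖X - p‖, ?_, ?_, ?_, fun X => rfl, ?_⟩
  · rw [contDiff_iff_contDiffAt]
    intro X
    by_cases hX : X = p
    · exact contDiffAt_const.congr_of_eventuallyEq (hnear X (by simpa [hX] using ha))
    · exact hηc.contDiffAt.comp X ((contDiffAt_id.sub contDiffAt_const).norm ℝ (sub_ne_zero.2 hX))
  · refine HasCompactSupport.intro (isCompact_closedBall p b) fun X hX => hη0 _ ?_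
    simp only [Metric.mem_closedBall, not_le, dist_eq_norm] at hX
    exact hX.le
  · refine (closure_minimal (fun X hX => ?_) Metric.isClosed_closedBall :
      _ ⊆ Metric.closedBall p b).trans (Metric.closedBall_subset_ball hb)
    by_contra h
    simp only [Metric.mem_closedBall, not_le, dist_eq_norm] at h
    exact hX (hη0 _ h.le)
  · intro X
    by_cases hX : X = p
    · have h1 : HasGradientAt (fun X => η ‖X - p‖) 0 X :=
        (hasGradientAt_const X (η 0)).congr_of_eventuallyEq (hnear X (by simpa [hX] using ha))
      rw [h1.gradient, hX]; simp
    · have hne : ‖X - p‖ ≠ 0 := norm_ne_zero_iff.2 (sub_ne_zero.2 hX)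
      have h1 : HasFDerivAt (fun X => ‖X - p‖) (‖X - p‖⁻¹ • innerSL ℝ (X - p)) X := by
        have h2 : HasFDerivAt (fun X : Euc n => ‖X - p‖ ^ 2) (2 • innerSL ℝ (X - p)) X := by
          simpa using! ((hasFDerivAt_id X).sub_const p).norm_sq
        have h3 := h2.sqrt (by positivity)
        simp only [Real.sqrt_sq (norm_nonneg _)] at h3
        convert! h3 using 1
        ext y
        simp
        field_simp
      have h4 := (hηd ‖X - p‖).comp_hasFDerivAt X h1
      have h5 : HasGradientAt (fun X => η ‖X - p‖)
          (-(ψ ‖X - p‖ • ‖X - p‖⁻¹ • (X - p))) X := by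
        rw [hasGradientAt_iff_hasFDerivAt]
        convert! h4 using 1
        ext y
        simp
      exact h5.gradient

/-- If `f = div K` in the weak sense on the ball `B_R(p)`, then `∫_{B_ρ(p)} f` is the flux of `K`
through the sphere of radius `ρ`, for almost every `ρ < R`. -/
lemma ae_integral_ball_eq_flux {n : ℕ} (p : Euc (n + 1)) {R : ℝ} (hR : 0 < R)
    {f : Euc (n + 1) → ℝ} {K : Euc (n + 1) → Euc (n + 1)} (hf : Integrable f) (hK : Integrable K)
    (h : ∀ φ : Euc (n + 1) → ℝ, ContDiff ℝ ∞ φ → HasCompactSupport φ →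
      tsupport φ ⊆ Metric.ball p R →
      (∫ X, φ X * f X) + ∫ X, inner ℝ (K X) (gradient φ X) = 0) :
    ∀ᵐ ρ : ℝ, ρ ∈ Ioo 0 R → ∫ X in Metric.ball p ρ, f X =
      ρ ^ n * ∫ θ, inner ℝ (K (p + ρ • (θ : Euc (n + 1)))) (θ : Euc (n + 1)) ∂sphereMeasure n := by
  set k : Euc (n + 1) → ℝ := fun X => inner ℝ (K X) (‖X - p‖⁻¹ • (X - p)) with hkdef
  have hk : Integrable k := by
    refine hK.norm.mono (hK.aestronglyMeasurable.inner (𝕜 := ℝ)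
      (by fun_prop : Measurable fun X : Euc (n + 1) => ‖X - p‖⁻¹ • (X - p)).aestronglyMeasurable)
      (Filter.Eventually.of_forall fun X => ?_)
    refine (norm_inner_le_norm _ _).trans ?_
    rw [norm_norm]
    refine mul_le_of_le_one_right (norm_nonneg _) ?_
    rw [norm_smul, norm_inv, norm_norm]
    exact inv_mul_le_one
  have hkθ : ∀ ρ : ℝ, 0 < ρ → ∀ θ : Metric.sphere (0 : Euc (n + 1)) 1,
      k (p + ρ • (θ : Euc (n + 1))) =
        inner ℝ (K (p + ρ • (θ : Euc (n + 1)))) (θ : Euc (n + 1)) := by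
    intro ρ hρ θ
    have hθ : ‖(θ : Euc (n + 1))‖ = 1 := norm_eq_of_mem_sphere θ
    simp only [hkdef, add_sub_cancel_left, norm_smul, hθ, mul_one, Real.norm_eq_abs,
      abs_of_pos hρ, smul_smul, inv_mul_cancel₀ hρ.ne', one_smul]
  set g : Euc (n + 1) × ℝ → ℝ := {q : Euc (n + 1) × ℝ | ‖q.1 - p‖ < q.2}.indicator
    (fun q => f q.1) with hg
  have hmeas : MeasurableSet {q : Euc (n + 1) × ℝ | ‖q.1 - p‖ < q.2} :=
    measurableSet_lt (by fun_prop) (by fun_prop)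
  have hgi : Integrable g (volume.prod (volume.restrict (Ioo 0 R))) :=
    (hf.comp_fst _).indicator hmeas
  have hF : ∀ s, ∫ X, g (X, s) = ∫ X in Metric.ball p s, f X := by
    intro s
    rw [← integral_indicator Metric.isOpen_ball.measurableSet]
    refine integral_congr_ae (Filter.Eventually.of_forall fun X => ?_)
    simp [hg, indicator, dist_eq_norm]
  have hFi : IntegrableOn (fun s => ∫ X in Metric.ball p s, f X) (Ioo 0 R) := by
    simp_rw [← hF]
    exact hgi.integral_prod_right
  have hJi : IntegrableOn (fun ρ => ρ ^ n * ∫ θ, k (p + ρ • (θ : Euc (n + 1))) ∂sphereMeasure n)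
      (Ioi 0) := by
    have := (integrable_polar p hk).integral_prod_left
    simp_rw [integral_const_mul] at this
    exact this
  -- By the fundamental lemma of the calculus of variations in the radius, it suffices to pair the
  -- difference of the two sides with every `ψ` supported in `(0, R)`.
  have key := isOpen_Ioo.ae_eq_zero_of_integral_contDiff_smul_eq_zero (μ := volume) (U := Ioo 0 R)
    (f := fun ρ => (∫ X in Metric.ball p ρ, f X) -
      ρ ^ n * ∫ θ, k (p + ρ • (θ : Euc (n + 1))) ∂sphereMeasure n)
    (hFi.sub (hJi.mono_set fun x hx => hx.1)).locallyIntegrableOn ?_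
  · filter_upwards [key] with ρ hρ hρR
    rw [sub_eq_zero.1 (hρ hρR)]
    simp_rw [hkθ ρ hρR.1]
  intro ψ hψ hc hs
  obtain ⟨φ, h1, h2, h3, h4, h5⟩ := exists_radial_test p hR hψ hc hs
  have hψ0 : ∀ s, s ∉ Ioo 0 R → ψ s = 0 := fun s hs' =>
    image_eq_zero_of_notMem_tsupport fun h => hs' (hs h)
  obtain ⟨C, hC⟩ := hc.exists_bound_of_continuous hψ.continuous
  have hψm : AEStronglyMeasurable ψ volume := hψ.continuous.aestronglyMeasurable
  -- Since `φ X` integrates `ψ s` over `s > ‖X - p‖`, Fubini turns this into an average of integrals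
  -- over the balls `‖X - p‖ < s`.
  have e1 : ∫ X, φ X * f X = ∫ s in Ioo 0 R, ψ s * ∫ X in Metric.ball p s, f X := by
    simp_rw [← hF, ← integral_const_mul]
    rw [← integral_integral_swap (f := fun (X : Euc (n + 1)) (s : ℝ) => ψ s * g (X, s))]
    · refine integral_congr_ae (Filter.Eventually.of_forall fun X => ?_)
      simp only
      rw [h4, ← integral_mul_const, ← integral_indicator measurableSet_Ioi,
        setIntegral_eq_integral_of_forall_compl_eq_zero]
      · refine integral_congr_ae (Filter.Eventually.of_forall fun s => ?_)
        by_cases hlt : ‖X - p‖ < s <;> simp [hg, hlt]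
      · intro s hs'
        simp [hψ0 s hs']
    · refine hgi.bdd_mul (c := C) ?_ (Filter.Eventually.of_forall fun q => hC q.2)
      exact (hψ.continuous.comp continuous_snd).aestronglyMeasurable
  have e2 : ∫ X, inner ℝ (K X) (gradient φ X) = -∫ s in Ioo 0 R,
      ψ s * (s ^ n * ∫ θ, k (p + s • (θ : Euc (n + 1))) ∂sphereMeasure n) := by
    have e3 : ∀ X, inner ℝ (K X) (gradient φ X) = -(ψ ‖X - p‖ * k X) := by
      intro X
      rw [h5, inner_neg_right, inner_smul_right]
    have hi : Integrable fun X => ψ ‖X - p‖ * k X := by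
      refine hk.bdd_mul (c := C) ?_ (Filter.Eventually.of_forall fun X => hC _)
      exact (hψ.continuous.comp (by fun_prop)).aestronglyMeasurable
    simp_rw [e3]
    rw [integral_neg, integral_polar p hi]
    congr 1
    have e6 : ∀ ρ ∈ Ioi (0 : ℝ),
        ρ ^ n * ∫ θ, ψ ‖p + ρ • (θ : Euc (n + 1)) - p‖ * k (p + ρ • (θ : Euc (n + 1)))
          ∂sphereMeasure n =
        ψ ρ * (ρ ^ n * ∫ θ, k (p + ρ • (θ : Euc (n + 1))) ∂sphereMeasure n) := by
      intro ρ (hρ : 0 < ρ)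
      have : ∀ θ : Metric.sphere (0 : Euc (n + 1)) 1, ‖p + ρ • (θ : Euc (n + 1)) - p‖ = ρ := by
        intro θ
        simp [norm_smul, abs_of_pos hρ]
      simp only [this, integral_const_mul]
      ring
    rw [setIntegral_congr_fun measurableSet_Ioi e6]
    refine setIntegral_eq_of_subset_of_forall_sdiff_eq_zero measurableSet_Ioi
      (fun x (hx : x ∈ Ioo 0 R) => hx.1) fun x hx => ?_
    rw [hψ0 x hx.2, zero_mul]
  have e4 := h φ h1 h2 h3
  rw [e1, e2, ← sub_eq_add_neg, ← integral_sub] at e4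
  · rw [← setIntegral_eq_integral_of_forall_compl_eq_zero (s := Ioo 0 R)]
    · refine Eq.trans ?_ e4
      refine integral_congr_ae (Filter.Eventually.of_forall fun s => ?_)
      simp only [smul_eq_mul]
      ring
    · intro s hs'
      simp [hψ0 s hs']
  · exact hFi.bdd_mul (c := C) hψm.restrict (Filter.Eventually.of_forall fun q => hC q)
  · exact (hJi.mono_set fun x (hx : x ∈ Ioo 0 R) => hx.1).bdd_mul (c := C) hψm.restrict
      (Filter.Eventually.of_forall fun q => hC q)

/-! ### Integration by parts, weak gradients and weakly harmonic functions -/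

section TestFunctions

variable {n : ℕ} {Ω : Set (Euc n)}

lemma continuous_smul_of_tsupport_subset {F : Type*} [NormedAddCommGroup F] [NormedSpace ℝ F]
    (hΩ : IsOpen Ω) {φ : Euc n → ℝ} {g : Euc n → F}
    (hφ : Continuous φ) (hs : tsupport φ ⊆ Ω) (hg : ContinuousOn g Ω) :
    Continuous fun X => φ X • g X :=
  continuous_of_tsupport fun _ hX => hφ.continuousAt.smul <|
    hg.continuousAt <| hΩ.mem_nhds <| hs <| tsupport_smul_subset_left _ _ hX

lemma integrable_smul_of_tsupport_subset {F : Type*} [NormedAddCommGroup F] [NormedSpace ℝ F]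
    (hΩ : IsOpen Ω) {φ : Euc n → ℝ} {g : Euc n → F}
    (hφ : Continuous φ) (hc : HasCompactSupport φ) (hs : tsupport φ ⊆ Ω) (hg : ContinuousOn g Ω) :
    Integrable fun X => φ X • g X :=
  (continuous_smul_of_tsupport_subset hΩ hφ hs hg).integrable_of_hasCompactSupport hc.smul_right

lemma continuousOn_fderiv_apply (hΩ : IsOpen Ω) {u : Euc n → ℝ} (hu : ContDiffOn ℝ 1 u Ω)
    (w : Euc n) : ContinuousOn (fun X => fderiv ℝ u X w) Ω :=
  (hu.continuousOn_fderiv_of_isOpen hΩ le_rfl).clm_apply continuousOn_const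

lemma continuousOn_gradient (hΩ : IsOpen Ω) {u : Euc n → ℝ} (hu : ContDiffOn ℝ 1 u Ω) :
    ContinuousOn (gradient u) Ω :=
  (InnerProductSpace.toDual ℝ (Euc n)).symm.continuous.comp_continuousOn
    (hu.continuousOn_fderiv_of_isOpen hΩ le_rfl)

/-- Nothing is asked of `u` outside `Ω`: each product has a factor `φ` or a derivative of `φ`,
supported inside `Ω`. -/
lemma integral_mul_fderiv_eq_neg_of_tsupport_subset (hΩ : IsOpen Ω) {φ u : Euc n → ℝ}
    (hφ : ContDiff ℝ 1 φ) (hc : HasCompactSupport φ) (hs : tsupport φ ⊆ Ω)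
    (hu : ContDiffOn ℝ 1 u Ω) (w : Euc n) :
    ∫ X, φ X * fderiv ℝ u X w = -∫ X, fderiv ℝ φ X w * u X := by
  have hφ' : Continuous fun X => fderiv ℝ φ X w :=
    (hφ.continuous_fderiv one_ne_zero).clm_apply continuous_const
  refine integral_mul_fderiv_eq_neg_fderiv_mul_of_integrable
    (integrable_smul_of_tsupport_subset hΩ hφ' (hc.fderiv_apply ℝ w)
      ((tsupport_fderiv_apply_subset ℝ w).trans hs) hu.continuousOn)
    (integrable_smul_of_tsupport_subset hΩ hφ.continuous hc hs (continuousOn_fderiv_apply hΩ hu w))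
    (integrable_smul_of_tsupport_subset hΩ hφ.continuous hc hs hu.continuousOn)
    (fun X _ => hφ.contDiffAt.differentiableAt one_ne_zero)
    (fun X hX => (hu.contDiffAt (hΩ.mem_nhds (hs hX))).differentiableAt one_ne_zero)

/-- The classical gradient of a `C¹` function is its weak gradient. -/
lemma gradient_ae_eq_of_hasWeakGradientOn (hΩ : IsOpen Ω) {u : Euc n → ℝ}
    (hu : ContDiffOn ℝ 1 u Ω) {G : Euc n → Euc n} (hG : IntegrableOn G Ω)
    (hw : HasWeakGradientOn u G Ω) : ∀ᵐ X, X ∈ Ω → gradient u X = G X := by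
  have key := hΩ.ae_eq_zero_of_integral_contDiff_smul_eq_zero (μ := volume)
    (f := fun X => gradient u X - G X)
    (((continuousOn_gradient hΩ hu).locallyIntegrableOn hΩ.measurableSet).sub
      hG.locallyIntegrableOn) ?_
  · filter_upwards [key] with X hX hXΩ
    exact sub_eq_zero.1 (hX hXΩ)
  intro φ hφ hc hs
  have hφ1 : ContDiff ℝ 1 φ := hφ.of_le (by simp)
  have hφ0 : ∀ X, X ∉ Ω → φ X = 0 := fun X hX =>
    image_eq_zero_of_notMem_tsupport fun h => hX (hs h)
  have hφg0 : ∀ X, X ∉ Ω → gradient φ X = 0 := fun X hX => by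
    have : X ∉ tsupport (fderiv ℝ φ) := fun h => hX (hs (tsupport_fderiv_subset ℝ h))
    rw [gradient, image_eq_zero_of_notMem_tsupport this, map_zero]
  obtain ⟨C, hC⟩ := hc.exists_bound_of_continuous hφ.continuous
  have hi1 : Integrable fun X => φ X • gradient u X :=
    integrable_smul_of_tsupport_subset hΩ hφ.continuous hc hs (continuousOn_gradient hΩ hu)
  have hi2 : IntegrableOn (fun X => φ X • G X) Ω :=
    hG.bdd_smul C hφ.continuous.aestronglyMeasurable
      (Filter.Eventually.of_forall fun q => hC q)
  have e1 : ∫ X, φ X • (gradient u X - G X) =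
      (∫ X in Ω, φ X • gradient u X) - ∫ X in Ω, φ X • G X := by
    rw [← integral_sub hi1.integrableOn hi2, ← setIntegral_eq_integral_of_forall_compl_eq_zero
      (s := Ω) fun X hX => by rw [hφ0 X hX, zero_smul]]
    simp_rw [smul_sub]
  have hi3 : Integrable fun X => u X • gradient φ X := by
    have hcont : Continuous (gradient φ) :=
      (InnerProductSpace.toDual ℝ (Euc n)).symm.continuous.comp
        (hφ1.continuous_fderiv one_ne_zero)
    have hts : tsupport (gradient φ) ⊆ tsupport φ := by
      refine (closure_mono fun X hX => ?_).trans (tsupport_fderiv_subset ℝ (f := φ))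
      simp only [Function.mem_support] at hX ⊢
      intro h; simp [gradient, h] at hX
    refine Continuous.integrable_of_hasCompactSupport (continuous_of_tsupport fun X hX => ?_) ?_
    · exact (hu.continuousOn.continuousAt (hΩ.mem_nhds
        (hs (hts (tsupport_smul_subset_right _ _ hX))))).smul hcont.continuousAt
    · have hcs : HasCompactSupport (gradient φ) :=
        hc.of_isClosed_subset (isClosed_tsupport _) hts
      exact hcs.smul_left (f := u)
  have e2 : ∫ X, φ X • gradient u X = -∫ X, u X • gradient φ X := by
    -- The vector identity is tested against constant vectors, where it is a scalar integration by
    -- parts.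
    refine ext_inner_left ℝ fun w => ?_
    rw [inner_neg_right, ← integral_inner hi1, ← integral_inner hi3]
    simp only [inner_smul_right, inner_gradient_right, conj_trivial]
    rw [integral_mul_fderiv_eq_neg_of_tsupport_subset hΩ hφ1 hc hs hu w]
    simp_rw [mul_comm]
  rw [e1, setIntegral_eq_integral_of_forall_compl_eq_zero fun X hX => by rw [hφ0 X hX, zero_smul],
    e2, ← setIntegral_eq_integral_of_forall_compl_eq_zero (s := Ω)
      fun X hX => by rw [hφg0 X hX, smul_zero], hw φ hφ hc hs, neg_neg, sub_self]

/-- `u` is `C¹` on `Ω` and satisfies `-Δu = 0` in the weak sense. -/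
def IsWeaklyHarmonicOn (u : Euc n → ℝ) (Ω : Set (Euc n)) : Prop :=
  ContDiffOn ℝ 1 u Ω ∧ ∀ ψ : Euc n → ℝ, ContDiff ℝ 1 ψ → HasCompactSupport ψ → tsupport ψ ⊆ Ω →
    ∫ X, inner ℝ (gradient u X) (gradient ψ X) = 0

/-- In the standard basis, one integration by parts in each direction leaves `ψ` times the
Laplacian. The weak form is kept from here on, as dilations and Green's identity need only first
derivatives. -/
lemma InnerProductSpace.HarmonicOnNhd.isWeaklyHarmonicOn (hΩ : IsOpen Ω) {u : Euc n → ℝ}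
    (hu : InnerProductSpace.HarmonicOnNhd u Ω) : IsWeaklyHarmonicOn u Ω := by
  have hu2 : ContDiffOn ℝ 2 u Ω := hu.contDiffOn
  refine ⟨hu2.of_le (by norm_num), fun ψ hψ hc hs => ?_⟩
  set b := EuclideanSpace.basisFun (Fin n) ℝ
  have hfd : ContDiffOn ℝ 1 (fderiv ℝ u) Ω := hu2.fderiv_of_isOpen hΩ (by norm_num)
  have hd : ∀ i, ContDiffOn ℝ 1 (fun X => fderiv ℝ u X (b i)) Ω := fun i =>
    hfd.clm_apply contDiffOn_const
  have hψ' : ∀ i, Continuous fun X => fderiv ℝ ψ X (b i) := fun i =>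
    (hψ.continuous_fderiv one_ne_zero).clm_apply continuous_const
  have e1 : ∀ X, inner ℝ (gradient u X) (gradient ψ X) =
      ∑ i, fderiv ℝ ψ X (b i) * fderiv ℝ u X (b i) := by
    intro X
    rw [← b.sum_inner_mul_inner]
    refine Finset.sum_congr rfl fun i _ => ?_
    rw [inner_gradient_left, inner_gradient_right, conj_trivial, mul_comm]
  have e2 : ∀ i, ∫ X, fderiv ℝ ψ X (b i) * fderiv ℝ u X (b i) =
      -∫ X, ψ X * fderiv ℝ (fun X => fderiv ℝ u X (b i)) X (b i) := fun i => by
    rw [integral_mul_fderiv_eq_neg_of_tsupport_subset hΩ hψ hc hs (hd i), neg_neg]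
  simp_rw [e1]
  rw [integral_finsetSum]
  · simp_rw [e2]
    rw [Finset.sum_neg_distrib, ← integral_finsetSum]
    · rw [neg_eq_zero]
      refine integral_eq_zero_of_ae (Filter.Eventually.of_forall fun X => ?_)
      by_cases hX : X ∈ tsupport ψ
      · have h1 : Laplacian.laplacian u X = 0 := (hu X (hs hX)).2.self_of_nhds
        rw [InnerProductSpace.laplacian_eq_iteratedFDeriv_orthonormalBasis u b] at h1
        simp only [iteratedFDeriv_two_apply] at h1
        simp only [Pi.zero_apply, ← Finset.mul_sum]
        rw [mul_eq_zero]
        right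
        rw [← h1]
        refine Finset.sum_congr rfl fun i _ => ?_
        have hdiff : DifferentiableAt ℝ (fderiv ℝ u) X :=
          (hfd.contDiffAt (hΩ.mem_nhds (hs hX))).differentiableAt one_ne_zero
        rw [fderiv_clm_apply hdiff (differentiableAt_const _)]
        simp
      · simp [image_eq_zero_of_notMem_tsupport hX]
    · intro i _
      exact integrable_smul_of_tsupport_subset hΩ hψ.continuous hc hs
        (continuousOn_fderiv_apply hΩ (hd i) _)
  · intro i _
    exact integrable_smul_of_tsupport_subset hΩ (hψ' i) (hc.fderiv_apply ℝ _)
      ((tsupport_fderiv_apply_subset ℝ _).trans hs) (hd i).continuousOn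

end TestFunctions

/-! ### Unique continuation for weakly harmonic functions -/

/-- The fundamental theorem of calculus on each fibre, followed by Fubini. Joint integrability
replaces a bound uniform in `τ`, which is not available for gradients near the flat boundary. -/
lemma integral_sub_integral_eq_of_hasDerivAt {Θ : Type*} [MeasurableSpace Θ] {ν : Measure Θ}
    [IsFiniteMeasure ν] {f f' : ℝ → Θ → ℝ} {a b : ℝ} (hab : a ≤ b)
    (hd : ∀ᵐ θ ∂ν, ∀ τ ∈ Icc a b, HasDerivAt (fun τ => f τ θ) (f' τ θ) τ)
    (hi : Integrable (Function.uncurry f') ((volume.restrict (Ioc a b)).prod ν))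
    (ha : Integrable (f a) ν) (hb : Integrable (f b) ν) :
    ∫ θ, f b θ ∂ν - ∫ θ, f a θ ∂ν = ∫ τ in a..b, ∫ θ, f' τ θ ∂ν := by
  rw [intervalIntegral.integral_of_le hab, integral_integral_swap hi, ← integral_sub hb ha]
  refine integral_congr_ae ?_
  filter_upwards [hd, hi.prod_left_ae] with θ hθ hθi
  rw [← intervalIntegral.integral_of_le hab, intervalIntegral.integral_eq_sub_of_hasDerivAt]
  · rwa [uIcc_of_le hab]
  · exact (intervalIntegrable_iff_integrableOn_Ioc_of_le hab).2 hθi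

/-! ### Gradient calculus; dilations and linear combinations of weakly harmonic functions. -/

section

variable {n : ℕ}

lemma gradient_eq_zero_of_notMem_tsupport {φ : Euc n → ℝ} {X : Euc n} (hX : X ∉ tsupport φ) :
    gradient φ X = 0 := by
  have : X ∉ tsupport (fderiv ℝ φ) := fun h => hX (tsupport_fderiv_subset ℝ h)
  rw [gradient, image_eq_zero_of_notMem_tsupport this, map_zero]

lemma integrable_inner_gradient {Ω : Set (Euc n)} (hΩ : IsOpen Ω) {V : Euc n → Euc n}
    (hV : ContinuousOn V Ω) {ψ : Euc n → ℝ} (hψ : ContDiff ℝ 1 ψ) (hc : HasCompactSupport ψ)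
    (hs : tsupport ψ ⊆ Ω) : Integrable fun X => inner ℝ (V X) (gradient ψ X) := by
  have hcont : Continuous (gradient ψ) :=
    (InnerProductSpace.toDual ℝ (Euc n)).symm.continuous.comp (hψ.continuous_fderiv one_ne_zero)
  have hsup : Function.support (fun X => inner ℝ (V X) (gradient ψ X)) ⊆ tsupport ψ := by
    intro X hX
    by_contra h
    refine hX ?_
    simp only
    rw [gradient_eq_zero_of_notMem_tsupport h, inner_zero_right]
  refine Continuous.integrable_of_hasCompactSupport (continuous_of_tsupport fun X hX => ?_)
    (hc.mono' hsup)
  exact (hV.continuousAt (hΩ.mem_nhds (hs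
    ((closure_minimal hsup (isClosed_tsupport ψ)) hX)))).inner hcont.continuousAt

lemma gradient_mul {u φ : Euc n → ℝ} {X : Euc n} (hu : DifferentiableAt ℝ u X)
    (hφ : DifferentiableAt ℝ φ X) :
    gradient (fun Z => u Z * φ Z) X = u X • gradient φ X + φ X • gradient u X := by
  simp only [gradient]
  rw [fderiv_fun_mul hu hφ]
  simp

lemma gradient_comp_add_smul {u : Euc n → ℝ} (p : Euc n) (t : ℝ) {X : Euc n}
    (hu : DifferentiableAt ℝ u (p + t • X)) :
    gradient (fun Z => u (p + t • Z)) X = t • gradient u (p + t • X) := by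
  have h1 : HasFDerivAt (fun Z : Euc n => p + t • Z) (t • ContinuousLinearMap.id ℝ (Euc n)) X :=
    ((hasFDerivAt_id X).const_smul t).const_add p
  have h2 := hu.hasFDerivAt.comp X h1
  refine HasGradientAt.gradient ?_
  rw [hasGradientAt_iff_hasFDerivAt]
  convert! h2 using 1
  ext y
  simp

lemma IsWeaklyHarmonicOn.mono {u : Euc n → ℝ} {Ω Ω' : Set (Euc n)} (hu : IsWeaklyHarmonicOn u Ω)
    (h : Ω' ⊆ Ω) : IsWeaklyHarmonicOn u Ω' :=
  ⟨hu.1.mono h, fun ψ h1 h2 h3 => hu.2 ψ h1 h2 (h3.trans h)⟩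

lemma IsWeaklyHarmonicOn.sub_const_mul {u w : Euc n → ℝ} {Ω : Set (Euc n)} (hΩ : IsOpen Ω)
    (hu : IsWeaklyHarmonicOn u Ω) (hw : IsWeaklyHarmonicOn w Ω) (c : ℝ) :
    IsWeaklyHarmonicOn (fun X => u X - c * w X) Ω := by
  refine ⟨hu.1.sub (contDiffOn_const.mul hw.1), fun ψ h1 h2 h3 => ?_⟩
  have e : ∀ X, inner ℝ (gradient (fun X => u X - c * w X) X) (gradient ψ X) =
      inner ℝ (gradient u X) (gradient ψ X) - c * inner ℝ (gradient w X) (gradient ψ X) := by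
    intro X
    by_cases hX : X ∈ tsupport ψ
    · have d1 := (hu.1.contDiffAt (hΩ.mem_nhds (h3 hX))).differentiableAt one_ne_zero
      have d2 := (hw.1.contDiffAt (hΩ.mem_nhds (h3 hX))).differentiableAt one_ne_zero
      simp only [inner_gradient_left]
      rw [fderiv_fun_sub d1 (d2.const_mul c), fderiv_const_mul d2]
      simp
    · simp [gradient_eq_zero_of_notMem_tsupport hX]
  simp_rw [e]
  rw [integral_sub (integrable_inner_gradient hΩ (continuousOn_gradient hΩ hu.1) h1 h2 h3)
    ((integrable_inner_gradient hΩ (continuousOn_gradient hΩ hw.1) h1 h2 h3).const_mul c),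
    integral_const_mul, hu.2 ψ h1 h2 h3, hw.2 ψ h1 h2 h3]
  simp

lemma IsWeaklyHarmonicOn.comp_add_smul {u : Euc n → ℝ} {Ω : Set (Euc n)} (hΩ : IsOpen Ω)
    (hu : IsWeaklyHarmonicOn u Ω) (p : Euc n) {t : ℝ} (ht : t ≠ 0) :
    IsWeaklyHarmonicOn (fun X => u (p + t • X)) ((fun X => p + t • X) ⁻¹' Ω) := by
  have hsm : ContDiff ℝ 1 fun X : Euc n => p + t • X := by fun_prop
  refine ⟨hu.1.comp hsm.contDiffOn fun X hX => hX, fun ψ h1 h2 h3 => ?_⟩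
  -- The test function in the variable `Y = p + t • X`. The factors from the chain rule and the
  -- Jacobian are irrelevant, because they multiply an integral equal to zero.
  set ψ' : Euc n → ℝ := fun Y => ψ (-(t⁻¹ • p) + t⁻¹ • Y) with hψ'
  have hinv : ∀ X : Euc n, -(t⁻¹ • p) + t⁻¹ • (p + t • X) = X := by
    intro X
    rw [smul_add, smul_smul, inv_mul_cancel₀ ht, one_smul, neg_add_cancel_left]
  have hinv' : ∀ X : Euc n, p + t • (-(t⁻¹ • p) + t⁻¹ • X) = X := by
    intro X
    rw [smul_add, smul_neg, smul_smul, smul_smul, mul_inv_cancel₀ ht, one_smul, one_smul,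
      add_neg_cancel_left]
  let e : Euc n ≃ₜ Euc n :=
    { toFun := fun Y => -(t⁻¹ • p) + t⁻¹ • Y
      invFun := fun X => p + t • X
      left_inv := hinv'
      right_inv := hinv
      continuous_toFun := by fun_prop
      continuous_invFun := by fun_prop }
  have hts : tsupport ψ' = e ⁻¹' tsupport ψ := tsupport_comp_eq_preimage ψ e
  have h1' : ContDiff ℝ 1 ψ' := h1.comp (by fun_prop)
  have h2' : HasCompactSupport ψ' := h2.comp_homeomorph e
  have h3' : tsupport ψ' ⊆ Ω := by
    rw [hts]
    intro Y hY
    have h : p + t • (-(t⁻¹ • p) + t⁻¹ • Y) ∈ Ω := h3 hY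
    rwa [hinv'] at h
  have key := hu.2 ψ' h1' h2' h3'
  have hpt : ∀ X, inner ℝ (gradient (fun X => u (p + t • X)) X) (gradient ψ X) =
      (fun Y => t * t * inner ℝ (gradient u Y) (gradient ψ' Y)) (p + t • X) := by
    intro X
    have hψX : gradient ψ X = t • gradient ψ' (p + t • X) := by
      rw [← gradient_comp_add_smul p t (h1'.contDiffAt.differentiableAt one_ne_zero)]
      simp only [hψ', hinv]
    by_cases hX : X ∈ tsupport ψ
    · have d1 : DifferentiableAt ℝ u (p + t • X) :=
        (hu.1.contDiffAt (hΩ.mem_nhds (h3 hX))).differentiableAt one_ne_zero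
      rw [gradient_comp_add_smul p t d1, hψX, real_inner_smul_left, real_inner_smul_right,
        ← mul_assoc]
    · have h0 := gradient_eq_zero_of_notMem_tsupport hX
      have h0' : gradient ψ' (p + t • X) = 0 := by
        rw [h0] at hψX
        exact ((smul_eq_zero.1 hψX.symm).resolve_left ht)
      simp [h0, h0']
  simp_rw [hpt]
  rw [Measure.integral_comp_smul volume
    (fun Z => (fun Y => t * t * inner ℝ (gradient u Y) (gradient ψ' Y)) (p + Z)),
    integral_add_left_eq_self (fun Y => t * t * inner ℝ (gradient u Y) (gradient ψ' Y)),
    integral_const_mul, key]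
  simp

end

/-! ### Green's identity and the propagation of zeros. -/

/-- Green's identity on spheres for a pair of weakly harmonic functions. -/
lemma integral_sphere_green {n : ℕ} {p : Euc (n + 1)} {R : ℝ} {w₁ w₂ : Euc (n + 1) → ℝ}
    (h₁ : IsWeaklyHarmonicOn w₁ (Metric.ball p R)) (h₂ : IsWeaklyHarmonicOn w₂ (Metric.ball p R))
    {ρ : ℝ} (hρ : ρ ∈ Ioo 0 R) :
    ∫ θ, inner ℝ (w₂ (p + ρ • (θ : Euc (n + 1))) • gradient w₁ (p + ρ • (θ : Euc (n + 1))) -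
      w₁ (p + ρ • (θ : Euc (n + 1))) • gradient w₂ (p + ρ • (θ : Euc (n + 1))))
        (θ : Euc (n + 1)) ∂sphereMeasure n = 0 := by
  have hO : IsOpen (Metric.ball p R) := Metric.isOpen_ball
  -- This field is divergence free: test `w₁` with `w₂ φ` and `w₂` with `w₁ φ`; the terms `φ ∇w₁ ·
  -- ∇w₂` cancel in the difference.
  set V : Euc (n + 1) → Euc (n + 1) := fun X => w₂ X • gradient w₁ X - w₁ X • gradient w₂ X
    with hV
  have hVc : ContinuousOn V (Metric.ball p R) :=
    (h₂.1.continuousOn.smul (continuousOn_gradient hO h₁.1)).sub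
      (h₁.1.continuousOn.smul (continuousOn_gradient hO h₂.1))
  -- `V` may fail to be integrable up to the sphere of radius `R`; it is continuous on the closed
  -- ball of radius `R'`.
  obtain ⟨R', hρR', hR'⟩ := exists_between hρ.2
  have hR'0 : 0 < R' := hρ.1.trans hρR'
  have hsub : Metric.closedBall p R' ⊆ Metric.ball p R := Metric.closedBall_subset_ball hR'
  have hsub' : Metric.ball p R' ⊆ Metric.ball p R := Metric.ball_subset_ball hR'.le
  have hVi : Integrable ((Metric.ball p R').indicator V) := by
    rw [integrable_indicator_iff Metric.isOpen_ball.measurableSet]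
    exact ((hVc.mono hsub).integrableOn_compact (isCompact_closedBall p R')).mono_set
      Metric.ball_subset_closedBall
  have key := ae_integral_ball_eq_flux p hR'0 (f := fun _ => 0) (integrable_zero _ _ _) hVi ?_
  · have hcont : ContinuousOn (fun ρ : ℝ => ∫ θ, inner ℝ (V (p + ρ • (θ : Euc (n + 1))))
        (θ : Euc (n + 1)) ∂sphereMeasure n) (Ioo 0 R') := by
      refine continuousOn_integral_of_compact_support (k := univ) isCompact_univ ?_ (by simp)
      refine ContinuousOn.inner (hVc.comp (f := fun q : ℝ × Metric.sphere (0 : Euc (n + 1)) 1 =>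
        p + q.1 • (q.2 : Euc (n + 1))) (by fun_prop) fun q hq => ?_) (by fun_prop)
      have hq1 : q.1 ∈ Ioo 0 R' := hq.1
      simp [norm_smul, abs_of_pos hq1.1]
      linarith [hq1.2]
    -- The flux vanishes for almost every radius and is continuous in the radius, so it vanishes for
    -- every radius.
    refine Measure.eqOn_open_of_ae_eq (μ := volume) (g := fun _ => (0 : ℝ)) ?_ isOpen_Ioo hcont
      continuousOn_const ⟨hρ.1, hρR'⟩
    rw [Filter.EventuallyEq, ae_restrict_iff' measurableSet_Ioo]
    filter_upwards [key] with s hs hsI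
    have h3 := hs hsI
    rw [integral_zero] at h3
    have h4 := (mul_eq_zero.1 h3.symm).resolve_left (pow_ne_zero _ hsI.1.ne')
    rw [← h4]
    refine integral_congr_ae (Filter.Eventually.of_forall fun θ => ?_)
    have : p + s • (θ : Euc (n + 1)) ∈ Metric.ball p R' := by
      simp [norm_smul, abs_of_pos hsI.1]
      exact hsI.2
    simp only [indicator_of_mem this]
  · intro φ hφ hc hs
    have hφ1 : ContDiff ℝ 1 φ := hφ.of_le (by simp)
    have hmul : ∀ w : Euc (n + 1) → ℝ, IsWeaklyHarmonicOn w (Metric.ball p R) →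
        ContDiff ℝ 1 (fun X => w X * φ X) ∧ HasCompactSupport (fun X => w X * φ X) ∧
          tsupport (fun X => w X * φ X) ⊆ tsupport φ := by
      intro w hw
      have hts : tsupport (fun X => w X * φ X) ⊆ tsupport φ := tsupport_mul_subset_right
      refine ⟨contDiff_iff_contDiffAt.2 fun X => ?_, hc.mul_left, hts⟩
      by_cases hX : X ∈ tsupport φ
      · exact (hw.1.contDiffAt (hO.mem_nhds (hsub' (hs hX)))).mul hφ1.contDiffAt
      · refine (contDiffAt_const (c := (0 : ℝ))).congr_of_eventuallyEq ?_
        filter_upwards [(isClosed_tsupport φ).isOpen_compl.mem_nhds hX] with Y hY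
        rw [image_eq_zero_of_notMem_tsupport hY, mul_zero]
    obtain ⟨a1, a2, a3⟩ := hmul w₁ h₁
    obtain ⟨b1, b2, b3⟩ := hmul w₂ h₂
    have e : ∀ X, inner ℝ ((Metric.ball p R').indicator V X) (gradient φ X) =
        inner ℝ (gradient w₁ X) (gradient (fun X => w₂ X * φ X) X) -
          inner ℝ (gradient w₂ X) (gradient (fun X => w₁ X * φ X) X) := by
      intro X
      by_cases hX : X ∈ tsupport φ
      · have d0 : DifferentiableAt ℝ φ X := hφ1.contDiffAt.differentiableAt one_ne_zero
        have d1 := (h₁.1.contDiffAt (hO.mem_nhds (hsub' (hs hX)))).differentiableAt one_ne_zero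
        have d2 := (h₂.1.contDiffAt (hO.mem_nhds (hsub' (hs hX)))).differentiableAt one_ne_zero
        rw [indicator_of_mem (hs hX), gradient_mul d1 d0, gradient_mul d2 d0, hV]
        simp only [inner_sub_left, inner_add_right, real_inner_smul_left, real_inner_smul_right]
        rw [real_inner_comm (gradient w₁ X) (gradient w₂ X)]
        ring
      · rw [gradient_eq_zero_of_notMem_tsupport hX,
          gradient_eq_zero_of_notMem_tsupport fun h => hX (a3 h),
          gradient_eq_zero_of_notMem_tsupport fun h => hX (b3 h)]
        simp only [inner_zero_right, sub_zero]
    simp_rw [e]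
    rw [integral_sub
      (integrable_inner_gradient hO (continuousOn_gradient hO h₁.1) b1 b2
        ((b3.trans hs).trans hsub'))
      (integrable_inner_gradient hO (continuousOn_gradient hO h₂.1) a1 a2
        ((a3.trans hs).trans hsub')),
      h₁.2 _ b1 b2 ((b3.trans hs).trans hsub'), h₂.2 _ a1 a2 ((a3.trans hs).trans hsub')]
    simp

/-- The integral `∫ u(p + m eᵗ θ) u(p + m e⁻ᵗ θ) dθ` over the unit sphere does not depend on `t`. -/
lemma integral_sphere_mul_exp_eq {n : ℕ} {p : Euc (n + 1)} {R : ℝ} {u : Euc (n + 1) → ℝ}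
    (hu : IsWeaklyHarmonicOn u (Metric.ball p R)) {m T : ℝ} (hm : 0 < m) (hT : 0 ≤ T)
    (hmT : m * Real.exp T < R) :
    ∫ θ, u (p + (m * Real.exp T) • (θ : Euc (n + 1))) *
        u (p + (m * Real.exp (-T)) • (θ : Euc (n + 1))) ∂sphereMeasure n =
      ∫ θ, u (p + m • (θ : Euc (n + 1))) ^ 2 ∂sphereMeasure n := by
  have hO : IsOpen (Metric.ball p R) := Metric.isOpen_ball
  set f : ℝ → Metric.sphere (0 : Euc (n + 1)) 1 → ℝ := fun τ θ =>
    u (p + (m * Real.exp τ) • (θ : Euc (n + 1))) * u (p + (m * Real.exp (-τ)) • (θ : Euc (n + 1)))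
    with hf
  set f' : ℝ → Metric.sphere (0 : Euc (n + 1)) 1 → ℝ := fun τ θ =>
    (m * Real.exp τ) * inner ℝ (gradient u (p + (m * Real.exp τ) • (θ : Euc (n + 1))))
        (θ : Euc (n + 1)) * u (p + (m * Real.exp (-τ)) • (θ : Euc (n + 1))) -
      u (p + (m * Real.exp τ) • (θ : Euc (n + 1))) * ((m * Real.exp (-τ)) *
        inner ℝ (gradient u (p + (m * Real.exp (-τ)) • (θ : Euc (n + 1)))) (θ : Euc (n + 1)))
    with hf'
  have hmem : ∀ s : ℝ, s ≤ T → ∀ θ : Metric.sphere (0 : Euc (n + 1)) 1,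
      p + (m * Real.exp s) • (θ : Euc (n + 1)) ∈ Metric.ball p R := by
    intro s hs θ
    have : m * Real.exp s ≤ m * Real.exp T := by gcongr
    simp [norm_smul, abs_of_pos hm]
    linarith
  have hcu : ∀ g : ℝ → ℝ, Continuous g → (∀ τ ∈ Icc 0 T, g τ ≤ T) →
      ContinuousOn (fun q : ℝ × Metric.sphere (0 : Euc (n + 1)) 1 =>
        u (p + (m * Real.exp (g q.1)) • (q.2 : Euc (n + 1)))) (Icc 0 T ×ˢ univ) ∧
      ContinuousOn (fun q : ℝ × Metric.sphere (0 : Euc (n + 1)) 1 =>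
        gradient u (p + (m * Real.exp (g q.1)) • (q.2 : Euc (n + 1)))) (Icc 0 T ×ˢ univ) := by
    intro g hg hgT
    have hc : ContinuousOn (fun q : ℝ × Metric.sphere (0 : Euc (n + 1)) 1 =>
      p + (m * Real.exp (g q.1)) • (q.2 : Euc (n + 1))) (Icc 0 T ×ˢ univ) := by fun_prop
    have hmaps : MapsTo (fun q : ℝ × Metric.sphere (0 : Euc (n + 1)) 1 =>
        p + (m * Real.exp (g q.1)) • (q.2 : Euc (n + 1))) (Icc 0 T ×ˢ univ) (Metric.ball p R) :=
      fun q hq => hmem _ (hgT _ hq.1) _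
    exact ⟨hu.1.continuousOn.comp hc hmaps, (continuousOn_gradient hO hu.1).comp hc hmaps⟩
  obtain ⟨c1, c2⟩ := hcu (fun τ => τ) continuous_id fun τ hτ => hτ.2
  obtain ⟨c3, c4⟩ := hcu (fun τ => -τ) continuous_neg fun τ hτ => by linarith [hτ.1]
  have hf'c : ContinuousOn (Function.uncurry f') (Icc 0 T ×ˢ univ) := by
    have cθ : ContinuousOn (fun q : ℝ × Metric.sphere (0 : Euc (n + 1)) 1 => (q.2 : Euc (n + 1)))
      (Icc 0 T ×ˢ univ) := by fun_prop
    have ce : ContinuousOn (fun q : ℝ × Metric.sphere (0 : Euc (n + 1)) 1 => m * Real.exp q.1)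
      (Icc 0 T ×ˢ univ) := by fun_prop
    have ce' : ContinuousOn (fun q : ℝ × Metric.sphere (0 : Euc (n + 1)) 1 => m * Real.exp (-q.1))
      (Icc 0 T ×ˢ univ) := by fun_prop
    exact ((ce.mul (c2.inner cθ)).mul c3).sub (c1.mul (ce'.mul (c4.inner cθ)))
  have hf'i : Integrable (Function.uncurry f')
      ((volume.restrict (Ioc 0 T)).prod (sphereMeasure n)) := by
    have h1 : IntegrableOn (Function.uncurry f') (Icc 0 T ×ˢ univ)
        (volume.prod (sphereMeasure n)) :=
      hf'c.integrableOn_compact (isCompact_Icc.prod isCompact_univ)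
    have h2 := h1.mono_set (prod_mono_left (t := univ) (Ioc_subset_Icc_self (a := 0) (b := T)))
    rwa [IntegrableOn, ← Measure.prod_restrict, Measure.restrict_univ] at h2
  have hfi : ∀ τ ∈ Icc 0 T, Integrable (f τ) (sphereMeasure n) := by
    intro τ hτ
    have h1 : Continuous (f τ) := by
      have h2 := (c1.mul c3).comp (f := fun θ : Metric.sphere (0 : Euc (n + 1)) 1 => (τ, θ))
        (s := univ) (by fun_prop) (fun θ _ => ⟨hτ, mem_univ _⟩)
      exact continuousOn_univ.1 h2
    have := h1.continuousOn.integrableOn_compact (μ := sphereMeasure n) (isCompact_univ)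
    rwa [integrableOn_univ] at this
  have hd : ∀ θ, ∀ τ ∈ Icc 0 T, HasDerivAt (fun τ => f τ θ) (f' τ θ) τ := by
    intro θ τ hτ
    have hray : ∀ s : ℝ, s ≤ T → HasDerivAt
        (fun s => u (p + (m * Real.exp s) • (θ : Euc (n + 1))))
        (m * Real.exp s * inner ℝ (gradient u (p + (m * Real.exp s) • (θ : Euc (n + 1))))
          (θ : Euc (n + 1))) s := by
      intro s hs
      have h1 := ((hu.1.contDiffAt (hO.mem_nhds (hmem s hs θ))).differentiableAt
        one_ne_zero).hasFDerivAt
      have h2 : HasDerivAt (fun s => p + (m * Real.exp s) • (θ : Euc (n + 1)))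
          ((m * Real.exp s) • (θ : Euc (n + 1))) s :=
        (((Real.hasDerivAt_exp s).const_mul m).smul_const _).const_add p
      have h3 := h1.comp_hasDerivAt s h2
      rw [inner_gradient_left]
      simpa using! h3
    have h1 := hray τ hτ.2
    have h2 := (hray (-τ) (by linarith [hτ.1, hτ.2])).comp τ (hasDerivAt_neg τ)
    convert! h1.mul h2 using 1
    simp only [hf', Function.comp]
    ring
  have hmain := integral_sub_integral_eq_of_hasDerivAt (ν := sphereMeasure n) hT
    (Filter.Eventually.of_forall hd) hf'i (hfi 0 ⟨le_rfl, hT⟩) (hfi T ⟨hT, le_rfl⟩)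
  -- The `τ`-derivative is `m` times the Green flux, through the sphere of radius `m`, of the
  -- dilates `u(p + e^τ X)` and `u(p + e^{-τ} X)`. Both are weakly harmonic on the ball of radius `R
  -- e^{-τ}`, which exceeds `m` because `m e^T < R`.
  have hzero : ∀ τ ∈ uIcc 0 T, ∫ θ, f' τ θ ∂sphereMeasure n = 0 := by
    intro τ hτ
    rw [uIcc_of_le hT] at hτ
    have hscale : ∀ s : ℝ, |s| ≤ τ → IsWeaklyHarmonicOn (fun X => u (p + Real.exp s • X))
        (Metric.ball 0 (R * Real.exp (-τ))) := by
      intro s hs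
      refine (hu.comp_add_smul hO p (Real.exp_pos s).ne').mono fun X hX => ?_
      simp only [Metric.mem_ball, dist_zero_right, mem_preimage, dist_self_add_left, norm_smul,
        Real.norm_eq_abs, Real.abs_exp] at hX ⊢
      have hR : 0 < R := lt_trans (by positivity) hmT
      calc Real.exp s * ‖X‖ < Real.exp s * (R * Real.exp (-τ)) := by gcongr
        _ = R * Real.exp (s - τ) := by rw [sub_eq_add_neg, Real.exp_add]; ring
        _ ≤ R * 1 := by
          gcongr
          rw [Real.exp_le_one_iff]
          linarith [le_abs_self s]
        _ = R := mul_one R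
    have habs : |τ| ≤ τ := (abs_of_nonneg hτ.1).le
    have hin : m ∈ Ioo 0 (R * Real.exp (-τ)) := by
      refine ⟨hm, ?_⟩
      rw [Real.exp_neg, ← div_eq_mul_inv, lt_div_iff₀ (Real.exp_pos τ)]
      have : m * Real.exp τ ≤ m * Real.exp T := by gcongr; exact hτ.2
      linarith
    have hg := integral_sphere_green (hscale τ habs) (hscale (-τ) (by rwa [abs_neg])) hin
    have hdu : ∀ s : ℝ, s ≤ T → ∀ θ : Metric.sphere (0 : Euc (n + 1)) 1,
        gradient (fun X => u (p + Real.exp s • X)) (0 + m • (θ : Euc (n + 1))) =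
          Real.exp s • gradient u (p + (m * Real.exp s) • (θ : Euc (n + 1))) := by
      intro s hs θ
      have hpt : p + Real.exp s • (0 + m • (θ : Euc (n + 1))) =
          p + (m * Real.exp s) • (θ : Euc (n + 1)) := by
        rw [zero_add, smul_smul, mul_comm]
      rw [gradient_comp_add_smul p _ ?_, hpt]
      rw [hpt]
      exact (hu.1.contDiffAt (hO.mem_nhds (hmem s hs θ))).differentiableAt one_ne_zero
    have h2 : ∀ θ : Metric.sphere (0 : Euc (n + 1)) 1, f' τ θ = m *
        inner ℝ (u (p + Real.exp (-τ) • (0 + m • (θ : Euc (n + 1)))) •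
          gradient (fun X => u (p + Real.exp τ • X)) (0 + m • (θ : Euc (n + 1))) -
          u (p + Real.exp τ • (0 + m • (θ : Euc (n + 1)))) •
            gradient (fun X => u (p + Real.exp (-τ) • X)) (0 + m • (θ : Euc (n + 1))))
          (θ : Euc (n + 1)) := by
      intro θ
      rw [hdu τ hτ.2, hdu (-τ) (by linarith [hτ.1, hτ.2])]
      simp only [hf', zero_add, smul_smul, inner_sub_left, real_inner_smul_left,
        mul_comm (Real.exp _) m]
      ring
    simp_rw [h2]
    rw [integral_const_mul, hg, mul_zero]
  rw [intervalIntegral.integral_congr (g := fun _ => (0 : ℝ)) hzero,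
    intervalIntegral.integral_zero, sub_eq_zero] at hmain
  simp only [hf, Real.exp_zero, mul_one, neg_zero] at hmain
  rw [hmain]
  simp_rw [sq]

/-- If a weakly harmonic function on `B_R(p)` vanishes on `B_ρ(p)`, then it vanishes on the ball
of radius `√(ρ R)`. -/
lemma IsWeaklyHarmonicOn.eqOn_zero_ball_sqrt {n : ℕ} {p : Euc (n + 1)} {R : ℝ}
    {u : Euc (n + 1) → ℝ} (hu : IsWeaklyHarmonicOn u (Metric.ball p R)) {ρ : ℝ} (hρ : 0 < ρ)
    (hρR : ρ ≤ R) (h0 : ∀ X ∈ Metric.ball p ρ, u X = 0) :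
    ∀ X ∈ Metric.ball p (Real.sqrt (ρ * R)), u X = 0 := by
  intro X hX
  by_cases hXρ : X ∈ Metric.ball p ρ
  · exact h0 X hXρ
  set m := ‖X - p‖ with hm
  have hmρ : ρ ≤ m := by simpa [dist_eq_norm] using hXρ
  have hm0 : 0 < m := hρ.trans_le hmρ
  have hm2 : m < Real.sqrt (ρ * R) := by simpa [dist_eq_norm] using hX
  have hm3 : m ^ 2 < ρ * R := (Real.lt_sqrt hm0.le).1 hm2
  have hlt : m / ρ < R / m := by
    rw [div_lt_div_iff₀ hρ hm0]
    nlinarith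
  -- Here `c = e^T`. The inner radius `m / c` has to be below `ρ`, where `u` vanishes, and the outer
  -- radius `m c` below `R`; such a `c` exists because `m² < ρ R`.
  obtain ⟨c, hc1, hc2⟩ := exists_between hlt
  have hc0 : 1 ≤ c := ((one_le_div hρ).2 hmρ).trans hc1.le
  have hce : Real.exp (Real.log c) = c := Real.exp_log (by linarith)
  have hmR : m < R := by
    have : ρ * R ≤ R * R := by gcongr; linarith
    nlinarith
  have key := integral_sphere_mul_exp_eq hu hm0 (Real.log_nonneg hc0) (by
    rw [hce]; rw [lt_div_iff₀ hm0] at hc2; linarith)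
  have hleft : ∀ θ : Metric.sphere (0 : Euc (n + 1)) 1,
      u (p + (m * Real.exp (-Real.log c)) • (θ : Euc (n + 1))) = 0 := by
    intro θ
    refine h0 _ ?_
    rw [Real.exp_neg, hce]
    have : m * c⁻¹ < ρ := by
      rw [← div_eq_mul_inv, div_lt_iff₀ (by linarith)]
      rw [div_lt_iff₀ hρ] at hc1
      linarith
    simpa [norm_smul, abs_of_pos hm0, abs_of_pos (show 0 < c by linarith)] using this
  simp only [hleft, mul_zero, integral_zero] at key
  have hcont : Continuous fun θ : Metric.sphere (0 : Euc (n + 1)) 1 =>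
      u (p + m • (θ : Euc (n + 1))) := by
    refine continuousOn_univ.1 (hu.1.continuousOn.comp
      (f := fun θ : Metric.sphere (0 : Euc (n + 1)) 1 => p + m • (θ : Euc (n + 1)))
      (by fun_prop) fun θ _ => ?_)
    simpa [norm_smul, abs_of_pos hm0] using hmR
  have hcont2 := hcont.pow 2
  have hint : Integrable (fun θ : Metric.sphere (0 : Euc (n + 1)) 1 =>
      u (p + m • (θ : Euc (n + 1))) ^ 2) (sphereMeasure n) := by
    have := hcont2.continuousOn.integrableOn_compact (μ := sphereMeasure n) (isCompact_univ)
    rwa [integrableOn_univ] at this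
  have hae := (integral_eq_zero_iff_of_nonneg (fun θ => sq_nonneg _) hint).1 key.symm
  have heq := (hcont2.ae_eq_iff_eq (sphereMeasure n) continuous_const).1 hae
  have hθ : m⁻¹ • (X - p) ∈ Metric.sphere (0 : Euc (n + 1)) 1 := by
    simp [norm_smul, ← hm, abs_of_pos hm0, hm0.ne']
  have h5 : u (p + m • (m⁻¹ • (X - p))) ^ 2 = 0 := congrFun heq ⟨_, hθ⟩
  rw [smul_smul, mul_inv_cancel₀ hm0.ne', one_smul, add_sub_cancel] at h5
  exact pow_eq_zero_iff two_ne_zero |>.1 h5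

/-- If `s ≤ R` is the largest radius on which `u` vanishes, `eqOn_zero_ball_sqrt` gives `√(s R) ≤
s`, hence `s = R`. -/
lemma IsWeaklyHarmonicOn.eqOn_zero_ball {n : ℕ} {p : Euc (n + 1)} {R : ℝ}
    {u : Euc (n + 1) → ℝ} (hu : IsWeaklyHarmonicOn u (Metric.ball p R)) {ρ : ℝ} (hρ : 0 < ρ)
    (h0 : ∀ X ∈ Metric.ball p ρ, u X = 0) : ∀ X ∈ Metric.ball p R, u X = 0 := by
  rcases le_or_gt R ρ with hle | hlt
  · exact fun X hX => h0 X (Metric.ball_subset_ball hle hX)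
  set S : Set ℝ := {s | s ≤ R ∧ ∀ X ∈ Metric.ball p s, u X = 0} with hS
  have hSb : BddAbove S := ⟨R, fun s hs => hs.1⟩
  have hρS : ρ ∈ S := ⟨hlt.le, h0⟩
  have hle : ρ ≤ sSup S := le_csSup hSb hρS
  have hpos : 0 < sSup S := hρ.trans_le hle
  have hsR : sSup S ≤ R := csSup_le ⟨ρ, hρS⟩ fun s hs => hs.1
  have hs0 : ∀ X ∈ Metric.ball p (sSup S), u X = 0 := by
    intro X hX
    obtain ⟨s, hs, hXs⟩ := exists_lt_of_lt_csSup ⟨ρ, hρS⟩ (Metric.mem_ball.1 hX)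
    exact hs.2 X hXs
  have hsq := hu.eqOn_zero_ball_sqrt hpos hsR hs0
  have hmem : Real.sqrt (sSup S * R) ∈ S := by
    refine ⟨?_, hsq⟩
    rw [Real.sqrt_le_left (by linarith)]
    nlinarith
  have h1 : Real.sqrt (sSup S * R) ≤ sSup S := le_csSup hSb hmem
  rw [Real.sqrt_le_left hpos.le] at h1
  have h2 : R ≤ sSup S := by nlinarith
  exact fun X hX => hs0 X (Metric.ball_subset_ball h2 hX)

/-- Unique continuation for weakly harmonic functions. -/
theorem IsWeaklyHarmonicOn.eqOn_zero_of_isPreconnected {n : ℕ} {u : Euc (n + 1) → ℝ}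
    {Ω : Set (Euc (n + 1))} (hΩ : IsOpen Ω) (hc : IsPreconnected Ω)
    (hu : IsWeaklyHarmonicOn u Ω) {O : Set (Euc (n + 1))} (hO : IsOpen O) (hne : (Ω ∩ O).Nonempty)
    (h0 : ∀ X ∈ O, u X = 0) : ∀ X ∈ Ω, u X = 0 := by
  have hsub : Ω ⊆ interior {X | u X = 0} := by
    refine hc.subset_of_closure_inter_subset isOpen_interior
      (hne.mono (inter_subset_inter_right _ (interior_maximal h0 hO))) ?_
    rintro X ⟨hX, hXΩ⟩
    -- The interior of the zero set is relatively closed in `Ω`: near a limit point `X` take `q` in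
    -- this interior within `ε / 2`. The ball of radius `ε / 2` about `q` stays in `Ω` and contains
    -- `X`, and the zeros near `q` spread to all of it.
    obtain ⟨ε, hε, hball⟩ := Metric.isOpen_iff.1 hΩ X hXΩ
    obtain ⟨q, hq, hXq⟩ := Metric.mem_closure_iff.1 hX (ε / 2) (by linarith)
    obtain ⟨ρ, hρ, hqρ⟩ := Metric.isOpen_iff.1 isOpen_interior q hq
    have hb : Metric.ball q (ε / 2) ⊆ Ω := by
      refine (Metric.ball_subset_ball' ?_).trans hball
      rw [dist_comm]; linarith
    have hz := (hu.mono hb).eqOn_zero_ball hρ fun Y hY =>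
      (interior_subset (hqρ hY) : Y ∈ {X | u X = 0})
    exact interior_maximal hz Metric.isOpen_ball (Metric.mem_ball.2 hXq)
  exact fun X hX => (interior_subset (hsub hX) : X ∈ {X | u X = 0})

/-! ### The differential inequality behind the monotonicity of the frequency -/

lemma AbsolutelyContinuousOnInterval.congr {f g : ℝ → ℝ} {a b : ℝ}
    (hf : AbsolutelyContinuousOnInterval f a b) (h : EqOn f g (uIcc a b)) :
    AbsolutelyContinuousOnInterval g a b := by
  rw [absolutelyContinuousOnInterval_iff] at hf ⊢
  intro ε hε
  obtain ⟨δ, hδ, hδE⟩ := hf ε hε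
  refine ⟨δ, hδ, fun E hE hlen => ?_⟩
  convert! hδE E hE hlen using 1
  refine Finset.sum_congr rfl fun i hi => ?_
  rw [h (hE.1 i hi).1, h (hE.1 i hi).2]

lemma AbsolutelyContinuousOnInterval.le_of_ae_deriv_nonneg {f : ℝ → ℝ} {a b : ℝ} (hab : a ≤ b)
    (hf : AbsolutelyContinuousOnInterval f a b)
    (h : ∀ᵐ x, x ∈ Ioc a b → 0 ≤ deriv f x) : f a ≤ f b := by
  have h1 := hf.integral_deriv_eq_sub
  have h2 : 0 ≤ ∫ x in a..b, deriv f x := by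
    rw [intervalIntegral.integral_of_le hab]
    exact integral_nonneg_of_ae ((ae_restrict_iff' measurableSet_Ioc).2 h)
  linarith

/-- The quantities in Almgren's monotonicity formula: `A r = ∫_{B_r} |∇v|²`, its density `a`,
`B r = ∫_{∂B_r} (∂_ν v)²` and the normalized boundary mass `H`. -/
structure AlmgrenData (n : ℕ) (A a B H : ℝ → ℝ) : Prop where
  intervalIntegrable : ∀ r, 0 < r → IntervalIntegrable a volume 0 r
  eq_integral : ∀ r, 0 < r → A r = ∫ s in (0 : ℝ)..r, a s
  energy_nonneg : ∀ r, 0 < r → 0 ≤ A r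
  mass_nonneg : ∀ r, 0 < r → 0 ≤ H r
  hasDerivAt_mass : ∀ r, 0 < r → HasDerivAt H (2 * A r / r ^ n) r
  pohozaev : ∀ᵐ r : ℝ, 0 < r → (1 - (n : ℝ)) * A r + r * a r = 2 * r * B r
  cauchySchwarz : ∀ᵐ r : ℝ, 0 < r → A r ^ 2 ≤ B r * (r ^ n * H r)

namespace AlmgrenData

variable {n : ℕ} {A a B H : ℝ → ℝ} (D : AlmgrenData n A a B H)
include D

lemma absolutelyContinuous_energy {c d : ℝ} (hc : 0 < c) (hcd : c ≤ d) :
    AbsolutelyContinuousOnInterval A c d := by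
  have hd : 0 < d := hc.trans_le hcd
  have h1 := (D.intervalIntegrable d hd).absolutelyContinuousOnInterval_intervalIntegral
    (c := 0) left_mem_uIcc
  have hsub : uIcc c d ⊆ uIcc 0 d := by
    rw [uIcc_of_le hcd, uIcc_of_le hd.le]
    exact Icc_subset_Icc_left hc.le
  refine (h1.mono hsub).congr fun x hx => ?_
  rw [uIcc_of_le hcd] at hx
  exact (D.eq_integral x (hc.trans_le hx.1)).symm

lemma continuousOn_energy : ContinuousOn A (Ioi 0) := by
  intro r (hr : 0 < r)
  have h1 := (D.absolutelyContinuous_energy (half_pos hr)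
    (by linarith : r / 2 ≤ 2 * r)).continuousOn
  rw [uIcc_of_le (by linarith)] at h1
  exact (h1.continuousAt (Icc_mem_nhds (by linarith) (by linarith))).continuousWithinAt

lemma ae_hasDerivAt_energy : ∀ᵐ r : ℝ, 0 < r → HasDerivAt A (a r) r := by
  -- The density is integrable on bounded intervals only, so `(0, ∞)` is exhausted by countably many
  -- of them and the null sets are united.
  have h1 : ∀ k : ℕ, ∀ᵐ r : ℝ, r ∈ Ioo 0 ((k : ℝ) + 1) → HasDerivAt A (a r) r := by
    intro k
    have hk : (0 : ℝ) < k + 1 := by positivity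
    filter_upwards [(D.intervalIntegrable _ hk).ae_hasDerivAt_integral] with r hr hrk
    have h2 := hr (by rw [uIcc_of_le hk.le]; exact Ioo_subset_Icc_self hrk) 0 left_mem_uIcc
    refine h2.congr_of_eventuallyEq ?_
    filter_upwards [Ioi_mem_nhds hrk.1] with s hs
    exact D.eq_integral s hs
  filter_upwards [ae_all_iff.2 h1] with r hr hr0
  obtain ⟨k, hk⟩ := exists_nat_gt r
  exact hr k ⟨hr0, by linarith⟩

lemma contDiffOn_mass : ContDiffOn ℝ 1 H (Ioi 0) := by
  rw [show (1 : WithTop ℕ∞) = 0 + 1 from rfl, contDiffOn_succ_iff_deriv_of_isOpen isOpen_Ioi]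
  refine ⟨fun r hr => (D.hasDerivAt_mass r hr).differentiableAt.differentiableWithinAt,
    by simp, contDiffOn_zero.2 ?_⟩
  have h1 : ContinuousOn (fun r => 2 * A r / r ^ n) (Ioi 0) :=
    (continuousOn_const.mul D.continuousOn_energy).div (by fun_prop)
      fun r hr => pow_ne_zero _ (ne_of_gt hr)
  exact h1.congr fun r hr => (D.hasDerivAt_mass r hr).deriv

lemma monotoneOn_mass : MonotoneOn H (Ioi 0) := by
  refine monotoneOn_of_deriv_nonneg (convex_Ioi 0) D.contDiffOn_mass.continuousOn ?_ ?_
  · rw [interior_Ioi]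
    exact fun r hr => (D.hasDerivAt_mass r hr).differentiableAt.differentiableWithinAt
  · rw [interior_Ioi]
    intro r (hr : 0 < r)
    rw [(D.hasDerivAt_mass r hr).deriv]
    have := D.energy_nonneg r hr
    positivity

/-- An absolutely continuous factor `A` times a `C¹` factor. Positivity at the left endpoint is
enough, because `H` is nondecreasing. The quotient is written with `r ^ n` to avoid the exponent `n
- 1`. -/
lemma absolutelyContinuous_frequency {c d : ℝ} (hc : 0 < c) (hcd : c ≤ d) (hH : 0 < H c) :
    AbsolutelyContinuousOnInterval (fun r => A r * r / (r ^ n * H r)) c d := by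
  have h1 : ContDiffOn ℝ 1 (fun r => r / (r ^ n * H r)) (uIcc c d) := by
    rw [uIcc_of_le hcd]
    have hsub : Icc c d ⊆ Ioi 0 := fun r hr => hc.trans_le hr.1
    refine contDiffOn_id.div ((contDiffOn_id.pow n).mul (D.contDiffOn_mass.mono hsub)) ?_
    intro r hr
    have hr0 : 0 < r := hsub hr
    have : 0 < H r := hH.trans_le (D.monotoneOn_mass hc hr0 hr.1)
    exact (mul_pos (pow_pos hr0 n) this).ne'
  refine ((D.absolutelyContinuous_energy hc hcd).mul h1.absolutelyContinuousOnInterval).congr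
    fun r _ => ?_
  simp only [Pi.mul_apply]
  ring

/-- The quotient rule produces `a r + (1 - n) A`, which Pohozaev replaces by `2 r B`; what survives
is the Cauchy–Schwarz deficit. -/
lemma ae_hasDerivAt_frequency : ∀ᵐ r : ℝ, 0 < r → 0 < H r →
    HasDerivAt (fun r => A r * r / (r ^ n * H r))
      (2 * r * (B r * (r ^ n * H r) - A r ^ 2) / (r ^ n * H r) ^ 2) r := by
  filter_upwards [D.ae_hasDerivAt_energy, D.pohozaev] with r h1 h2 hr hH
  have h3 := ((h1 hr).mul (hasDerivAt_id r)).div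
    ((hasDerivAt_pow n r).mul (D.hasDerivAt_mass r hr)) (mul_pos (pow_pos hr n) hH).ne'
  convert! h3 using 1
  simp only [Pi.mul_apply, id]
  congr 1
  have h4 : a r * r = 2 * r * B r - (1 - (n : ℝ)) * A r := by linarith [h2 hr]
  -- Multiplied by `r`, the identity also covers `n = 0`, where `n - 1` is truncated.
  have hn : (n : ℝ) * r ^ (n - 1) * r = n * r ^ n := by
    rcases n with _ | m
    · simp
    · rw [Nat.add_sub_cancel, pow_succ]; ring
  rw [h4, mul_div_cancel₀ _ (pow_ne_zero n hr.ne')]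
  linear_combination (A r * H r) * hn

lemma frequency_le {c d : ℝ} (hc : 0 < c) (hcd : c ≤ d) (hH : 0 < H c) :
    A c * c / (c ^ n * H c) ≤ A d * d / (d ^ n * H d) := by
  refine (D.absolutelyContinuous_frequency hc hcd hH).le_of_ae_deriv_nonneg hcd ?_
  filter_upwards [D.ae_hasDerivAt_frequency, D.cauchySchwarz] with r h1 h2 hr
  have hr0 : 0 < r := hc.trans hr.1
  have hHr : 0 < H r := hH.trans_le (D.monotoneOn_mass hc hr0 hr.1.le)
  rw [(h1 hr0 hHr).deriv]
  have := sub_nonneg.2 (h2 hr0)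
  positivity

/-- To the right of `R`, monotonicity of `H` suffices. To the left, let `s` be the last zero before
`R`. On `(s, R)` the frequency is at most its value `C` at `R`, so `H' ≤ (2C / s) H` and `H t
e^{-Lt}` with `L = 2C / s` is nonincreasing; it vanishes at `s`, hence at `R`, a contradiction. -/
lemma mass_pos {R : ℝ} (hR : 0 < R) (hHR : 0 < H R) {r : ℝ} (hr : 0 < r) : 0 < H r := by
  by_contra hcon
  have hHr : H r = 0 := le_antisymm (not_lt.1 hcon) (D.mass_nonneg r hr)
  have hrR : r < R := by
    by_contra h
    have := D.monotoneOn_mass hR hr (not_lt.1 h)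
    linarith
  have hcont : ContinuousOn H (Icc r R) :=
    D.contDiffOn_mass.continuousOn.mono fun s hs => hr.trans_le hs.1
  set Z : Set ℝ := Icc r R ∩ H ⁻¹' {0} with hZ
  have hZc : IsCompact Z := isCompact_Icc.of_isClosed_subset
    (hcont.preimage_isClosed_of_isClosed isClosed_Icc isClosed_singleton) inter_subset_left
  obtain ⟨s, hs, hsmax⟩ := hZc.exists_isGreatest ⟨r, ⟨le_rfl, hrR.le⟩, hHr⟩
  have hs0 : 0 < s := hr.trans_le hs.1.1
  have hHs : H s = 0 := hs.2
  have hsR : s < R := lt_of_le_of_ne hs.1.2 fun h => by rw [h] at hHs; linarith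
  have hpos : ∀ t, s < t → t ≤ R → 0 < H t := by
    intro t hst htR
    refine lt_of_le_of_ne (D.mass_nonneg t (hs0.trans hst)) fun h => ?_
    exact absurd (hsmax ⟨⟨hs.1.1.trans hst.le, htR⟩, h.symm⟩) (not_le.2 hst)
  set C := A R * R / (R ^ n * H R) with hC
  have hC0 : 0 ≤ C := by
    have := D.energy_nonneg R hR
    positivity
  set L := 2 * C / s with hL
  have hanti : AntitoneOn (fun t => H t * Real.exp (-(L * t))) (Icc s R) := by
    have hd : ∀ t, s < t → HasDerivAt (fun t => H t * Real.exp (-(L * t)))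
        (2 * A t / t ^ n * Real.exp (-(L * t)) + H t * (Real.exp (-(L * t)) * -(L * 1))) t := by
      intro t ht
      exact (D.hasDerivAt_mass t (hs0.trans ht)).mul
        (((hasDerivAt_id t).const_mul L).neg.exp)
    refine antitoneOn_of_deriv_nonpos (convex_Icc s R) ?_ ?_ ?_
    · exact (D.contDiffOn_mass.continuousOn.mono fun t ht => hs0.trans_le ht.1).mul (by fun_prop)
    · rw [interior_Icc]
      exact fun t ht => (hd t ht.1).differentiableAt.differentiableWithinAt
    · rw [interior_Icc]
      intro t ht
      have ht0 : 0 < t := hs0.trans ht.1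
      have hHt := hpos t ht.1 ht.2.le
      rw [(hd t ht.1).deriv]
      have h1 : A t * t / (t ^ n * H t) ≤ C := D.frequency_le ht0 ht.2.le hHt
      have h2 : 2 * A t / t ^ n = 2 * (A t * t / (t ^ n * H t)) / t * H t := by
        field_simp
      have h3 : 2 * (A t * t / (t ^ n * H t)) / t ≤ L := by
        rw [hL]
        gcongr
        exact ht.1.le
      have h4 : 2 * A t / t ^ n ≤ L * H t := by
        rw [h2]; gcongr
      have h5 : 0 < Real.exp (-(L * t)) := Real.exp_pos _
      nlinarith
  have h1 := hanti ⟨le_rfl, hsR.le⟩ ⟨hsR.le, le_rfl⟩ hsR.le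
  simp only [hHs, zero_mul] at h1
  have : 0 < H R * Real.exp (-(L * R)) := by positivity
  linarith

lemma hasDerivAt_log_mass {r : ℝ} (hr : 0 < r) (hH : 0 < H r) :
    HasDerivAt (fun s => Real.log (H s)) (2 * (A r * r / (r ^ n * H r)) / r) r := by
  convert! (D.hasDerivAt_mass r hr).log hH.ne' using 1
  field_simp

/-- If the frequency is constant on an interval, then equality holds in the Cauchy–Schwarz
inequality almost everywhere on this interval. -/
lemma ae_eq_of_frequency_const {γ c d : ℝ} (hc : 0 ≤ c) (hH : ∀ r, 0 < r → 0 < H r)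
    (h : ∀ r ∈ Ioo c d, A r * r / (r ^ n * H r) = γ) :
    ∀ᵐ r : ℝ, r ∈ Ioo c d → B r * (r ^ n * H r) = A r ^ 2 := by
  filter_upwards [D.ae_hasDerivAt_frequency] with r h1 hr
  have hr0 : 0 < r := hc.trans_lt hr.1
  have hHr := hH r hr0
  have h2 : HasDerivAt (fun r => A r * r / (r ^ n * H r)) 0 r := by
    refine (hasDerivAt_const r γ).congr_of_eventuallyEq ?_
    filter_upwards [isOpen_Ioo.mem_nhds hr] with s hs
    exact h s hs
  have h3 := (h1 hr0 hHr).unique h2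
  rw [div_eq_zero_iff] at h3
  have h4 := h3.resolve_right (by positivity)
  have h5 := (mul_eq_zero.1 h4).resolve_left (by positivity)
  linarith

end AlmgrenData

/-! ### The half space and half balls -/

section HalfSpace

variable {n : ℕ}

lemma continuous_last : Continuous fun X : Euc (n + 1) => X (Fin.last n) := by fun_prop

lemma isOpen_upperHalf : IsOpen (upperHalf n) := isOpen_lt continuous_const continuous_last

lemma isClosed_closedUpperHalf : IsClosed (closedUpperHalf n) :=
  isClosed_le continuous_const continuous_last

lemma upperHalf_subset_closedUpperHalf : upperHalf n ⊆ closedUpperHalf n :=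
  fun X (hX : 0 < X (Fin.last n)) => hX.le

lemma isPreconnected_upperHalf : IsPreconnected (upperHalf n) := by
  refine Convex.isPreconnected fun X (hX : 0 < X _) Y (hY : 0 < Y _) s t hs ht hst => ?_
  change 0 < (s • X + t • Y) (Fin.last n)
  simp only [PiLp.add_apply, PiLp.smul_apply, smul_eq_mul]
  rcases hs.lt_or_eq with h | rfl
  · nlinarith [mul_pos h hX, mul_nonneg ht hY.le]
  · rw [zero_add] at hst; subst hst; linarith

lemma closedUpperHalf_subset_closure : closedUpperHalf n ⊆ closure (upperHalf n) := by
  intro X (hX : 0 ≤ X (Fin.last n))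
  have h1 : Continuous fun t : ℝ => X + t • EuclideanSpace.single (Fin.last n) (1 : ℝ) := by
    fun_prop
  have h2 : Filter.Tendsto (fun t : ℝ => X + t • EuclideanSpace.single (Fin.last n) (1 : ℝ))
      (nhdsWithin 0 (Ioi 0)) (nhds X) := by
    have := (h1.tendsto 0).mono_left (nhdsWithin_le_nhds (s := Ioi 0))
    simpa using this
  refine mem_closure_of_tendsto h2 ?_
  filter_upwards [self_mem_nhdsWithin] with t (ht : 0 < t)
  change 0 < (X + t • EuclideanSpace.single (Fin.last n) (1 : ℝ)) (Fin.last n)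
  simp
  linarith

lemma bdryPt_last (x₀ : Euc n) : bdryPt x₀ (Fin.last n) = 0 := by
  simp [bdryPt]

lemma bdryPt_add_mem_upperHalf (x₀ : Euc n) {ξ : Euc (n + 1)} :
    bdryPt x₀ + ξ ∈ upperHalf n ↔ ξ ∈ upperHalf n := by
  simp [upperHalf, bdryPt_last]

lemma bdryPt_add_mem_closedUpperHalf (x₀ : Euc n) {ξ : Euc (n + 1)} :
    bdryPt x₀ + ξ ∈ closedUpperHalf n ↔ ξ ∈ closedUpperHalf n := by
  simp [closedUpperHalf, bdryPt_last]

lemma smul_mem_upperHalf {t : ℝ} (ht : 0 < t) {ξ : Euc (n + 1)} :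
    t • ξ ∈ upperHalf n ↔ ξ ∈ upperHalf n := by
  simp [upperHalf, ht]

lemma smul_mem_closedUpperHalf {t : ℝ} (ht : 0 < t) {ξ : Euc (n + 1)} :
    t • ξ ∈ closedUpperHalf n ↔ ξ ∈ closedUpperHalf n := by
  simp [closedUpperHalf, ht]

/-- The open upper half of the unit sphere. -/
abbrev upperSphere (n : ℕ) : Set (Metric.sphere (0 : Euc (n + 1)) 1) :=
  {θ | (θ : Euc (n + 1)) ∈ upperHalf n}

lemma isOpen_upperSphere : IsOpen (upperSphere n) :=
  isOpen_upperHalf.preimage continuous_subtype_val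

lemma isOpen_halfBall (X₀ : Euc (n + 1)) (r : ℝ) : IsOpen (halfBall n X₀ r) :=
  Metric.isOpen_ball.inter isOpen_upperHalf

lemma polar_mem_halfBall (x₀ : Euc n) {ρ r : ℝ} (hρ : 0 < ρ)
    (θ : Metric.sphere (0 : Euc (n + 1)) 1) :
    bdryPt x₀ + ρ • (θ : Euc (n + 1)) ∈ halfBall n (bdryPt x₀) r ↔
      ρ < r ∧ θ ∈ upperSphere n := by
  rw [halfBall, mem_inter_iff, bdryPt_add_mem_upperHalf, smul_mem_upperHalf hρ]
  simp [norm_smul, abs_of_pos hρ]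

lemma integrable_polar_halfBall (x₀ : Euc n) {r : ℝ} {F : Euc (n + 1) → ℝ}
    (hF : IntegrableOn F (halfBall n (bdryPt x₀) r)) :
    Integrable (fun q : ℝ × Metric.sphere (0 : Euc (n + 1)) 1 =>
      q.1 ^ n * F (bdryPt x₀ + q.1 • (q.2 : Euc (n + 1))))
      ((volume.restrict (Ioo 0 r)).prod ((sphereMeasure n).restrict (upperSphere n))) := by
  have hm := (isOpen_halfBall (bdryPt x₀) r).measurableSet
  have h1 := integrable_polar (bdryPt x₀) ((integrable_indicator_iff hm).2 hF)
  rw [← Measure.restrict_univ (μ := sphereMeasure n), Measure.prod_restrict, ← IntegrableOn] at h1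
  rw [Measure.prod_restrict, ← IntegrableOn]
  refine (h1.mono_set (prod_mono (fun x (hx : x ∈ Ioo 0 r) => hx.1)
    (subset_univ (upperSphere n)))).congr_fun (fun q hq => ?_)
    (measurableSet_Ioo.prod isOpen_upperSphere.measurableSet)
  have : bdryPt x₀ + q.1 • (q.2 : Euc (n + 1)) ∈ halfBall n (bdryPt x₀) r :=
    (polar_mem_halfBall x₀ hq.1.1 q.2).2 ⟨hq.1.2, hq.2⟩
  simp only [indicator_of_mem this]

lemma intervalIntegrable_halfSphereIntegral (x₀ : Euc n) {r : ℝ} (hr : 0 ≤ r)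
    {F : Euc (n + 1) → ℝ} (hF : IntegrableOn F (halfBall n (bdryPt x₀) r)) :
    IntervalIntegrable (fun ρ => halfSphereIntegral n ρ fun ξ => F (bdryPt x₀ + ξ))
      volume 0 r := by
  rw [intervalIntegrable_iff_integrableOn_Ioo_of_le hr]
  have := (integrable_polar_halfBall x₀ hF).integral_prod_left
  simp_rw [integral_const_mul] at this
  exact this

lemma integral_halfBall_eq (x₀ : Euc n) {r : ℝ} (hr : 0 ≤ r) {F : Euc (n + 1) → ℝ}
    (hF : IntegrableOn F (halfBall n (bdryPt x₀) r)) :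
    ∫ X in halfBall n (bdryPt x₀) r, F X =
      ∫ ρ in (0 : ℝ)..r, halfSphereIntegral n ρ fun ξ => F (bdryPt x₀ + ξ) := by
  have hm := (isOpen_halfBall (bdryPt x₀) r).measurableSet
  rw [← integral_indicator hm, integral_polar (bdryPt x₀) ((integrable_indicator_iff hm).2 hF),
    intervalIntegral.integral_of_le hr, integral_Ioc_eq_integral_Ioo,
    setIntegral_eq_of_subset_of_forall_sdiff_eq_zero measurableSet_Ioi
      (fun x (hx : x ∈ Ioo 0 r) => hx.1)]
  · refine setIntegral_congr_fun measurableSet_Ioo fun ρ hρ => ?_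
    simp only [halfSphereIntegral]
    congr 1
    rw [← integral_indicator isOpen_upperSphere.measurableSet]
    refine integral_congr_ae (Filter.Eventually.of_forall fun θ => ?_)
    have := polar_mem_halfBall x₀ (r := r) hρ.1 θ
    beta_reduce
    by_cases hθ : θ ∈ upperSphere n
    · rw [indicator_of_mem hθ, indicator_of_mem (this.2 ⟨hρ.2, hθ⟩)]
    · rw [indicator_of_notMem hθ, indicator_of_notMem fun h => hθ (this.1 h).2]
  · intro ρ hρ
    have hρ0 : 0 < ρ := hρ.1
    have hρr : ¬ ρ < r := fun h => hρ.2 ⟨hρ0, h⟩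
    have : ∀ θ : Metric.sphere (0 : Euc (n + 1)) 1,
        (halfBall n (bdryPt x₀) r).indicator F (bdryPt x₀ + ρ • (θ : Euc (n + 1))) = 0 :=
      fun θ => indicator_of_notMem (fun h => hρr ((polar_mem_halfBall x₀ hρ0 θ).1 h).1) _
    simp only [this, integral_zero, mul_zero]

/-- A function which is integrable on all half balls is integrable on almost all half spheres. -/
lemma ae_integrableOn_upperSphere (x₀ : Euc n) {F : Euc (n + 1) → ℝ}
    (hF : ∀ r, 0 < r → IntegrableOn F (halfBall n (bdryPt x₀) r)) :
    ∀ᵐ ρ : ℝ, 0 < ρ →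
      IntegrableOn (fun θ : Metric.sphere (0 : Euc (n + 1)) 1 =>
        F (bdryPt x₀ + ρ • (θ : Euc (n + 1)))) (upperSphere n) (sphereMeasure n) := by
  have h1 : ∀ k : ℕ, ∀ᵐ ρ : ℝ, ρ ∈ Ioo 0 ((k : ℝ) + 1) →
      IntegrableOn (fun θ : Metric.sphere (0 : Euc (n + 1)) 1 =>
        F (bdryPt x₀ + ρ • (θ : Euc (n + 1)))) (upperSphere n) (sphereMeasure n) := by
    intro k
    have h2 := (integrable_polar_halfBall x₀ (hF (k + 1) (by positivity))).prod_right_ae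
    rw [ae_restrict_iff' measurableSet_Ioo] at h2
    filter_upwards [h2] with ρ hρ hρk
    have h3 := (hρ hρk).const_mul (ρ ^ n)⁻¹
    have h4 : ρ ^ n ≠ 0 := pow_ne_zero _ hρk.1.ne'
    simp only [← mul_assoc, inv_mul_cancel₀ h4, one_mul] at h3
    exact h3
  filter_upwards [ae_all_iff.2 h1] with ρ hρ hρ0
  obtain ⟨k, hk⟩ := exists_nat_gt ρ
  exact hρ k ⟨hρ0, by linarith⟩

end HalfSpace

/-! ### Energy identities for segregation profiles -/

instance isFiniteMeasure_restrict_halfBall {n : ℕ} (X₀ : Euc (n + 1)) (r : ℝ) :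
    IsFiniteMeasure (volume.restrict (halfBall n X₀ r)) :=
  ⟨by
    rw [Measure.restrict_apply_univ]
    exact (measure_mono inter_subset_left).trans_lt measure_ball_lt_top⟩

namespace IsSegregationProfile

variable {N k : ℕ} {v : Fin k → Euc (N + 1) → ℝ} (hv : IsSegregationProfile v)
include hv

lemma isWeaklyHarmonicOn (i : Fin k) : IsWeaklyHarmonicOn (v i) (upperHalf N) :=
  (hv.harmonic i).isWeaklyHarmonicOn isOpen_upperHalf

lemma contDiffOn (i : Fin k) : ContDiffOn ℝ 1 (v i) (upperHalf N) :=
  (hv.isWeaklyHarmonicOn i).1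

lemma differentiableAt (i : Fin k) {X : Euc (N + 1)} (hX : X ∈ upperHalf N) :
    DifferentiableAt ℝ (v i) X :=
  ((hv.contDiffOn i).contDiffAt (isOpen_upperHalf.mem_nhds hX)).differentiableAt one_ne_zero

lemma continuousOn_grad (i : Fin k) : ContinuousOn (gradient (v i)) (upperHalf N) :=
  continuousOn_gradient isOpen_upperHalf (hv.contDiffOn i)

/-- The `H¹` hypothesis provides some square integrable weak gradient. It agrees almost everywhere
with the classical one, because `v i` is `C¹` in the open half space. -/
lemma memLp_gradient (i : Fin k) (X₀ : Euc (N + 1)) (r : ℝ) :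
    MemLp (gradient (v i)) 2 (volume.restrict (halfBall N X₀ r)) := by
  obtain ⟨-, G, hG, hw⟩ := hv.memH1Loc i (Metric.ball X₀ r) Metric.isOpen_ball
    Metric.isBounded_ball
  change MemLp G 2 (volume.restrict (halfBall N X₀ r)) at hG
  have hae := gradient_ae_eq_of_hasWeakGradientOn (isOpen_halfBall X₀ r)
    ((hv.contDiffOn i).mono inter_subset_right) (hG.integrable one_le_two) hw
  refine hG.ae_eq ?_
  rw [Filter.EventuallyEq, ae_restrict_iff' ((isOpen_halfBall X₀ r).measurableSet)]
  filter_upwards [hae] with X hX hXm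
  exact (hX hXm).symm

lemma integrableOn_norm_gradient_sq (i : Fin k) (X₀ : Euc (N + 1)) (r : ℝ) :
    IntegrableOn (fun X => ‖gradient (v i) X‖ ^ 2) (halfBall N X₀ r) :=
  (hv.memLp_gradient i X₀ r).integrable_norm_pow two_ne_zero

lemma exists_bound (i : Fin k) (X₀ : Euc (N + 1)) (r : ℝ) :
    ∃ C, ∀ X ∈ Metric.closedBall X₀ r ∩ closedUpperHalf N, ‖v i X‖ ≤ C :=
  ((isCompact_closedBall X₀ r).inter_right isClosed_closedUpperHalf).exists_bound_of_continuousOn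
    ((hv.continuousOn i).mono inter_subset_right)

lemma integrableOn_smul_gradient (i : Fin k) (X₀ : Euc (N + 1)) (r : ℝ) :
    IntegrableOn (fun X => v i X • gradient (v i) X) (halfBall N X₀ r) := by
  obtain ⟨C, hC⟩ := hv.exists_bound i X₀ r
  have hm := (isOpen_halfBall X₀ r).measurableSet
  have h1 : AEStronglyMeasurable (v i) (volume.restrict (halfBall N X₀ r)) :=
    (((hv.contDiffOn i).continuousOn).mono inter_subset_right).aestronglyMeasurable hm
  have h2 : ∀ᵐ X ∂volume.restrict (halfBall N X₀ r), ‖v i X‖ ≤ C := by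
    rw [ae_restrict_iff' hm]
    exact Filter.Eventually.of_forall fun X hX =>
      hC X ⟨Metric.ball_subset_closedBall hX.1, upperHalf_subset_closedUpperHalf hX.2⟩
  exact ((hv.memLp_gradient i X₀ r).integrable one_le_two).bdd_smul C h1 h2

/-- The energy in a half ball is the flux of `vᵢ ∇vᵢ` through its spherical part. -/
lemma ae_energy_eq_flux (i : Fin k) (x₀ : Euc N) :
    ∀ᵐ ρ : ℝ, 0 < ρ → ∫ X in halfBall N (bdryPt x₀) ρ, ‖gradient (v i) X‖ ^ 2 =
      halfSphereIntegral N ρ fun ξ => v i (bdryPt x₀ + ξ) *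
        inner ℝ (gradient (v i) (bdryPt x₀ + ξ)) (ρ⁻¹ • ξ) := by
  have main : ∀ m : ℕ, ∀ᵐ ρ : ℝ, ρ ∈ Ioo 0 ((m : ℝ) + 1) →
      ∫ X in halfBall N (bdryPt x₀) ρ, ‖gradient (v i) X‖ ^ 2 =
      halfSphereIntegral N ρ fun ξ => v i (bdryPt x₀ + ξ) *
        inner ℝ (gradient (v i) (bdryPt x₀ + ξ)) (ρ⁻¹ • ξ) := by
    intro m
    set R : ℝ := (m : ℝ) + 1 with hR
    have hR0 : 0 < R := by positivity
    have hm := (isOpen_halfBall (bdryPt x₀) R).measurableSet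
    -- After extension by zero across `y = 0`, the boundary condition says exactly that `f = div K`
    -- weakly on the full ball: test functions need not vanish on `y = 0`, and the flat part carries
    -- no flux of `v i ∇(v i)`.
    set f : Euc (N + 1) → ℝ :=
      (halfBall N (bdryPt x₀) R).indicator fun X => ‖gradient (v i) X‖ ^ 2 with hf
    set K : Euc (N + 1) → Euc (N + 1) :=
      (halfBall N (bdryPt x₀) R).indicator fun X => v i X • gradient (v i) X with hK
    have hfi : Integrable f :=
      (integrable_indicator_iff hm).2 (hv.integrableOn_norm_gradient_sq i _ R)
    have hKi : Integrable K :=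
      (integrable_indicator_iff hm).2 (hv.integrableOn_smul_gradient i _ R)
    have key := ae_integral_ball_eq_flux (bdryPt x₀) hR0 hfi hKi ?_
    · filter_upwards [key] with ρ hρ hρR
      have h1 := hρ hρR
      have h2 : ∫ X in Metric.ball (bdryPt x₀) ρ, f X =
          ∫ X in halfBall N (bdryPt x₀) ρ, ‖gradient (v i) X‖ ^ 2 := by
        rw [hf, setIntegral_indicator hm]
        congr 2
        ext X
        simp only [halfBall, mem_inter_iff, Metric.mem_ball]
        constructor
        · exact fun h => ⟨h.1, h.2.2⟩
        · exact fun h => ⟨h.1, h.1.trans hρR.2, h.2⟩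
      rw [← h2, h1, halfSphereIntegral, ← integral_indicator isOpen_upperSphere.measurableSet]
      congr 1
      refine integral_congr_ae (Filter.Eventually.of_forall fun θ => ?_)
      beta_reduce
      have h3 := polar_mem_halfBall x₀ (r := R) hρR.1 θ
      by_cases hθ : θ ∈ upperSphere N
      · rw [indicator_of_mem hθ, hK, indicator_of_mem (h3.2 ⟨hρR.2, hθ⟩), real_inner_smul_left,
          smul_smul, inv_mul_cancel₀ hρR.1.ne', one_smul]
      · rw [indicator_of_notMem hθ, hK, indicator_of_notMem fun h => hθ (h3.1 h).2,
          inner_zero_left]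
    · intro φ hφ hc hs
      have hφ1 : ContDiff ℝ 1 φ := hφ.of_le (by simp)
      have hgφ : Continuous (gradient φ) :=
        (InnerProductSpace.toDual ℝ (Euc (N + 1))).symm.continuous.comp
          (hφ1.continuous_fderiv one_ne_zero)
      have hcg : HasCompactSupport (gradient φ) := by
        refine hc.mono' fun X hX => ?_
        by_contra h
        exact hX (gradient_eq_zero_of_notMem_tsupport h)
      obtain ⟨C₁, hC₁⟩ := hc.exists_bound_of_continuous hφ.continuous
      obtain ⟨C₂, hC₂⟩ := hcg.exists_bound_of_continuous hgφ
      have i1 : Integrable fun X => φ X * f X :=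
        hfi.bdd_mul (c := C₁) hφ.continuous.aestronglyMeasurable
          (Filter.Eventually.of_forall hC₁)
      have i2 : Integrable fun X => inner ℝ (K X) (gradient φ X) := by
        refine (hKi.norm.const_mul C₂).mono
          (hKi.aestronglyMeasurable.inner hgφ.aestronglyMeasurable)
          (Filter.Eventually.of_forall fun X => ?_)
        refine (norm_inner_le_norm _ _).trans ?_
        rw [norm_mul, norm_norm, mul_comm]
        gcongr
        exact (hC₂ X).trans (le_abs_self _)
      rw [← integral_add i1 i2, ← hv.boundary i φ hφ hc,
        ← integral_indicator isOpen_upperHalf.measurableSet]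
      refine integral_congr_ae (Filter.Eventually.of_forall fun X => ?_)
      beta_reduce
      by_cases hX : X ∈ upperHalf N
      · rw [indicator_of_mem hX, gradient_mul (hv.differentiableAt i hX)
          (hφ1.contDiffAt.differentiableAt one_ne_zero)]
        by_cases hXφ : X ∈ tsupport φ
        · have hXb : X ∈ halfBall N (bdryPt x₀) R := ⟨hs hXφ, hX⟩
          rw [hf, hK, indicator_of_mem hXb, indicator_of_mem hXb]
          simp only [inner_add_right, real_inner_smul_left, real_inner_smul_right,
            real_inner_self_eq_norm_sq]
          ring
        · rw [gradient_eq_zero_of_notMem_tsupport hXφ, image_eq_zero_of_notMem_tsupport hXφ]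
          simp only [zero_mul, inner_zero_right, smul_zero, zero_smul, add_zero]
      · have hXb : X ∉ halfBall N (bdryPt x₀) R := fun h => hX h.2
        rw [indicator_of_notMem hX, hf, hK, indicator_of_notMem hXb, indicator_of_notMem hXb,
          inner_zero_left, mul_zero, add_zero]
  filter_upwards [ae_all_iff.2 main] with ρ hρ hρ0
  obtain ⟨m, hm⟩ := exists_nat_gt ρ
  exact hρ m ⟨hρ0, by linarith⟩

lemma continuousOn_ray (i : Fin k) (x₀ : Euc N) {ρ : ℝ} (hρ : 0 < ρ) :
    ContinuousOn (fun θ : Metric.sphere (0 : Euc (N + 1)) 1 =>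
      v i (bdryPt x₀ + ρ • (θ : Euc (N + 1)))) (upperSphere N) :=
  (hv.continuousOn i).comp (f := fun θ : Metric.sphere (0 : Euc (N + 1)) 1 =>
    bdryPt x₀ + ρ • (θ : Euc (N + 1))) (by fun_prop) fun θ hθ =>
      upperHalf_subset_closedUpperHalf
        ((bdryPt_add_mem_upperHalf x₀).2 ((smul_mem_upperHalf hρ).2 hθ))

lemma integrableOn_sq_upperSphere (i : Fin k) (x₀ : Euc N) {ρ : ℝ} (hρ : 0 < ρ) :
    IntegrableOn (fun θ : Metric.sphere (0 : Euc (N + 1)) 1 =>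
      v i (bdryPt x₀ + ρ • (θ : Euc (N + 1))) ^ 2) (upperSphere N) (sphereMeasure N) := by
  obtain ⟨C, hC⟩ := hv.exists_bound i (bdryPt x₀) ρ
  have hm := (isOpen_upperSphere (n := N)).measurableSet
  refine Integrable.of_bound (((hv.continuousOn_ray i x₀ hρ).pow 2).aestronglyMeasurable hm)
    (C ^ 2) ?_
  rw [ae_restrict_iff' hm]
  refine Filter.Eventually.of_forall fun θ hθ => ?_
  rw [norm_pow]
  gcongr
  refine hC _ ⟨?_, upperHalf_subset_closedUpperHalf
    ((bdryPt_add_mem_upperHalf x₀).2 ((smul_mem_upperHalf hρ).2 hθ))⟩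
  simp [norm_smul, abs_of_pos hρ]

lemma hasDerivAt_ray (i : Fin k) (x₀ : Euc N) {ρ : ℝ} (hρ : 0 < ρ) {ξ : Euc (N + 1)}
    (hξ : ξ ∈ upperHalf N) :
    HasDerivAt (fun ρ => v i (bdryPt x₀ + ρ • ξ))
      (inner ℝ (gradient (v i) (bdryPt x₀ + ρ • ξ)) ξ) ρ := by
  have h1 := (hv.differentiableAt i ((bdryPt_add_mem_upperHalf x₀).2
    ((smul_mem_upperHalf hρ).2 hξ))).hasFDerivAt
  have h2 : HasDerivAt (fun ρ : ℝ => bdryPt x₀ + ρ • ξ) ((1 : ℝ) • ξ) ρ :=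
    ((hasDerivAt_id ρ).smul_const ξ).const_add _
  have h3 := h1.comp_hasDerivAt ρ h2
  rw [inner_gradient_left]
  simpa using! h3

lemma integrableOn_mul_inner (i : Fin k) (x₀ : Euc N) (r : ℝ) :
    IntegrableOn (fun X => v i X * inner ℝ (gradient (v i) X)
      (‖X - bdryPt x₀‖⁻¹ • (X - bdryPt x₀))) (halfBall N (bdryPt x₀) r) := by
  refine (hv.integrableOn_smul_gradient i (bdryPt x₀) r).norm.mono ?_
    (Filter.Eventually.of_forall fun X => ?_)
  · have := (hv.integrableOn_smul_gradient i (bdryPt x₀) r).aestronglyMeasurable.inner (𝕜 := ℝ)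
      ((by fun_prop : Measurable fun X : Euc (N + 1) =>
        ‖X - bdryPt x₀‖⁻¹ • (X - bdryPt x₀)).aestronglyMeasurable)
    simpa only [real_inner_smul_left] using this
  · rw [← real_inner_smul_left, norm_norm]
    refine (norm_inner_le_norm _ _).trans (mul_le_of_le_one_right (norm_nonneg _) ?_)
    rw [norm_smul, norm_inv, norm_norm]
    exact inv_mul_le_one

/-- Along a ray in the open half space `v i ^ 2` has derivative `2 v i ∂_ρ(v i)`, whose spherical
integral is the energy by `ae_energy_eq_flux`. That formula holds for almost every radius only,
hence the integrated form; continuity of the energy in `r` later yields the derivative at every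
radius. -/
lemma integral_sq_sub (i : Fin k) (x₀ : Euc N) {r₁ r₂ : ℝ} (h₁ : 0 < r₁) (h₁₂ : r₁ ≤ r₂) :
    ∫ θ in upperSphere N, v i (bdryPt x₀ + r₂ • (θ : Euc (N + 1))) ^ 2 ∂sphereMeasure N -
      ∫ θ in upperSphere N, v i (bdryPt x₀ + r₁ • (θ : Euc (N + 1))) ^ 2 ∂sphereMeasure N =
    ∫ ρ in r₁..r₂, 2 * (∫ X in halfBall N (bdryPt x₀) ρ, ‖gradient (v i) X‖ ^ 2) / ρ ^ N := by
  set ν := (sphereMeasure N).restrict (upperSphere N) with hν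
  have hm := (isOpen_upperSphere (n := N)).measurableSet
  set F : Euc (N + 1) → ℝ := fun X => v i X * inner ℝ (gradient (v i) X)
      (‖X - bdryPt x₀‖⁻¹ • (X - bdryPt x₀)) with hF
  have hFθ : ∀ ρ : ℝ, 0 < ρ → ∀ θ : Metric.sphere (0 : Euc (N + 1)) 1,
      F (bdryPt x₀ + ρ • (θ : Euc (N + 1))) = v i (bdryPt x₀ + ρ • (θ : Euc (N + 1))) *
        inner ℝ (gradient (v i) (bdryPt x₀ + ρ • (θ : Euc (N + 1)))) (θ : Euc (N + 1)) := by
    intro ρ hρ θ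
    have hθ : ‖(θ : Euc (N + 1))‖ = 1 := norm_eq_of_mem_sphere θ
    simp only [hF, add_sub_cancel_left, norm_smul, hθ, mul_one, Real.norm_eq_abs,
      abs_of_pos hρ, smul_smul, inv_mul_cancel₀ hρ.ne', one_smul]
  -- The polar integrability is over an open interval of radii; the radius `r₂ + 1` makes it contain
  -- `r₂`. Dividing by the weight `ρ ^ N` is harmless since `ρ > r₁`.
  have hi := integrable_polar_halfBall x₀ (hv.integrableOn_mul_inner i x₀ (r₂ + 1))
  have hi2 : Integrable (Function.uncurry fun (ρ : ℝ) (θ : Metric.sphere (0 : Euc (N + 1)) 1) =>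
      2 * (v i (bdryPt x₀ + ρ • (θ : Euc (N + 1))) *
        inner ℝ (gradient (v i) (bdryPt x₀ + ρ • (θ : Euc (N + 1)))) (θ : Euc (N + 1))))
      ((volume.restrict (Ioc r₁ r₂)).prod ν) := by
    rw [Measure.prod_restrict] at hi
    rw [hν, Measure.prod_restrict]
    have h1 := IntegrableOn.mono_set hi (prod_mono_left (t := upperSphere N)
      (fun x (hx : x ∈ Ioc r₁ r₂) => ⟨h₁.trans hx.1, by linarith [hx.2]⟩ :
        Ioc r₁ r₂ ⊆ Ioo 0 (r₂ + 1)))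
    have hms : MeasurableSet (Ioc r₁ r₂ ×ˢ upperSphere N) := measurableSet_Ioc.prod hm
    have h2 := Integrable.bdd_mul (c := (r₁ ^ N)⁻¹)
      (f := fun q : ℝ × Metric.sphere (0 : Euc (N + 1)) 1 => (q.1 ^ N)⁻¹) h1
      (by fun_prop : Measurable _).aestronglyMeasurable (by
        rw [ae_restrict_iff' hms]
        refine Filter.Eventually.of_forall fun q hq => ?_
        have : r₁ < q.1 := hq.1.1
        have hq0 : 0 < q.1 := h₁.trans this
        rw [norm_inv, norm_pow, Real.norm_eq_abs, abs_of_pos hq0]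
        gcongr)
    refine IntegrableOn.congr_fun (h2.const_mul 2) (fun q hq => ?_) hms
    have hq0 : 0 < q.1 := h₁.trans hq.1.1
    have h3 := hFθ q.1 hq0 q.2
    simp only [hF] at h3
    simp only [Function.uncurry, h3]
    rw [inv_mul_cancel_left₀ (pow_ne_zero N hq0.ne')]
  have hd : ∀ᵐ θ : Metric.sphere (0 : Euc (N + 1)) 1 ∂ν, ∀ τ ∈ Icc r₁ r₂,
      HasDerivAt (fun τ => v i (bdryPt x₀ + τ • (θ : Euc (N + 1))) ^ 2)
        (2 * (v i (bdryPt x₀ + τ • (θ : Euc (N + 1))) *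
          inner ℝ (gradient (v i) (bdryPt x₀ + τ • (θ : Euc (N + 1)))) (θ : Euc (N + 1)))) τ := by
    rw [hν, ae_restrict_iff' hm]
    refine Filter.Eventually.of_forall fun θ hθ τ hτ => ?_
    have := (hv.hasDerivAt_ray i x₀ (h₁.trans_le hτ.1) hθ).pow 2
    convert! this using 1
    ring
  rw [integral_sub_integral_eq_of_hasDerivAt
    (f := fun τ (θ : Metric.sphere (0 : Euc (N + 1)) 1) =>
      v i (bdryPt x₀ + τ • (θ : Euc (N + 1))) ^ 2) h₁₂ hd hi2
    (hv.integrableOn_sq_upperSphere i x₀ h₁)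
    (hv.integrableOn_sq_upperSphere i x₀ (h₁.trans_le h₁₂))]
  refine intervalIntegral.integral_congr_ae ?_
  filter_upwards [hv.ae_energy_eq_flux i x₀] with ρ hρ hρI
  rw [uIoc_of_le h₁₂] at hρI
  have hρ0 : 0 < ρ := h₁.trans hρI.1
  rw [hρ hρ0, halfSphereIntegral, integral_const_mul, ← mul_assoc, mul_comm 2 (ρ ^ N), mul_assoc,
    mul_div_cancel_left₀ _ (pow_ne_zero N hρ0.ne')]
  congr 2
  ext θ
  rw [smul_smul, inv_mul_cancel₀ hρ0.ne', one_smul]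

end IsSegregationProfile

/-! ### Radial energies and the Pohozaev identity on half balls. -/

/-- The Dirichlet energy of `v` in the half ball. -/
def halfBallEnergy {N k : ℕ} (v : Fin k → Euc (N + 1) → ℝ) (x₀ : Euc N) (r : ℝ) : ℝ :=
  ∫ X in halfBall N (bdryPt x₀) r, ∑ i, ‖gradient (v i) X‖ ^ 2

/-- The integral of `|∇v|²` over the half sphere. -/
def halfSphereEnergy {N k : ℕ} (v : Fin k → Euc (N + 1) → ℝ) (x₀ : Euc N) (r : ℝ) : ℝ :=
  halfSphereIntegral N r fun ξ => ∑ i, ‖gradient (v i) (bdryPt x₀ + ξ)‖ ^ 2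

/-- The integral of `(∂_ν v)²` over the half sphere. -/
def halfSphereRadialEnergy {N k : ℕ} (v : Fin k → Euc (N + 1) → ℝ) (x₀ : Euc N) (r : ℝ) : ℝ :=
  halfSphereIntegral N r fun ξ =>
    ∑ i, (inner ℝ (gradient (v i) (bdryPt x₀ + ξ)) (r⁻¹ • ξ)) ^ 2

/-- The isometry `ℝ^{N+1} × ℝ⁰ ≃ ℝ^{N+1}`. -/
def trivialSplitting (N : ℕ) : WithLp 2 (Euc (N + 1) × Euc 0) ≃ₗᵢ[ℝ] Euc (N + 1) where
  toFun p := p.fst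
  invFun X := WithLp.toLp 2 (X, 0)
  map_add' _ _ := rfl
  map_smul' _ _ := rfl
  left_inv p := by
    apply (WithLp.equiv 2 (Euc (N + 1) × Euc 0)).injective
    exact Prod.ext rfl (Subsingleton.elim _ _)
  right_inv _ := rfl
  norm_map' p := by
    change ‖p.fst‖ = ‖p‖
    rw [WithLp.prod_norm_eq_of_L2, Subsingleton.elim p.snd 0]
    simp

lemma setIntegral_cube_zero (l : ℝ) (g : Euc 0 → ℝ) : ∫ η in cube 0 l, g η = g 0 := by
  have h1 : cube 0 l = univ := by
    ext η
    simp [cube]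
  have h2 : (volume : Measure (Euc 0)) univ = 1 := by
    have h := (EuclideanSpace.volume_preserving_symm_measurableEquiv_toLp (Fin 0)).measure_preimage
      (s := univ) MeasurableSet.univ.nullMeasurableSet
    rw [preimage_univ] at h
    rw [h, volume_pi, Measure.pi_univ, Finset.univ_eq_empty, Finset.prod_empty]
  have h3 : g = fun _ => g 0 := funext fun η => congrArg g (Subsingleton.elim η 0)
  rw [h1, Measure.restrict_univ, h3, integral_const, measureReal_def, h2]
  simp

/-- With `h = N` the partial gradient is the whole gradient, so the bulk coefficient is `2 - (N + 1)
= 1 - N`. The cube is a point of mass one and has no faces, so `l` disappears. -/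
lemma pohozaevOn_trivialSplitting {N k : ℕ} {v : Fin k → Euc (N + 1) → ℝ} {X₀ : Euc (N + 1)}
    {r l : ℝ} (h : PohozaevOn (trivialSplitting N) v X₀ r l) (hX₀ : X₀ (Fin.last N) = 0) :
    (∫ X in halfBall N X₀ r, ∑ i, (1 - (N : ℝ)) * ‖gradient (v i) X‖ ^ 2) +
      r * halfSphereIntegral N r (fun ξ => ∑ i, ‖gradient (v i) (X₀ + ξ)‖ ^ 2) =
    2 * r * halfSphereIntegral N r (fun ξ =>
      ∑ i, (inner ℝ (gradient (v i) (X₀ + ξ)) (r⁻¹ • ξ)) ^ 2) := by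
  have hcyl : halfCylinder (trivialSplitting N) X₀ r l = halfBall N X₀ r := by
    ext X
    change (X - X₀ ∈ halfBall N 0 r ∧ (0 : Euc 0) ∈ cube 0 l) ↔ _
    have : (0 : Euc 0) ∈ cube 0 l := by simp [cube]
    simp only [this, and_true, halfBall, mem_inter_iff, Metric.mem_ball, upperHalf,
      mem_ofPred_eq, dist_eq_norm, sub_zero]
    simp [hX₀]
  unfold PohozaevOn at h
  rw [hcyl] at h
  simp only [setIntegral_cube_zero, Finset.univ_eq_empty, Finset.sum_empty, mul_zero,
    add_zero] at h
  refine Eq.trans ?_ h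
  congr 1
  refine integral_congr_ae (Filter.Eventually.of_forall fun X => ?_)
  refine Finset.sum_congr rfl fun i _ => ?_
  change _ = 2 * ‖gradient (v i) X‖ ^ 2 - ((N : ℝ) + 1) * ‖gradient (v i) X‖ ^ 2
  ring

/-! ### The energies of a profile as Almgren data. -/

namespace IsSegregationProfile

variable {N k : ℕ} {v : Fin k → Euc (N + 1) → ℝ} (hv : IsSegregationProfile v)
include hv

lemma integrableOn_energy (X₀ : Euc (N + 1)) (r : ℝ) :
    IntegrableOn (fun X => ∑ i, ‖gradient (v i) X‖ ^ 2) (halfBall N X₀ r) :=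
  integrable_finsetSum _ fun i _ => hv.integrableOn_norm_gradient_sq i X₀ r

lemma halfBallEnergy_eq_sum (x₀ : Euc N) (r : ℝ) : halfBallEnergy v x₀ r =
    ∑ i, ∫ X in halfBall N (bdryPt x₀) r, ‖gradient (v i) X‖ ^ 2 :=
  integral_finsetSum _ fun i _ => hv.integrableOn_norm_gradient_sq i _ r

lemma almgrenH_eq_sum (x₀ : Euc N) {r : ℝ} (hr : 0 < r) : almgrenH v x₀ r =
    ∑ i, ∫ θ in upperSphere N, v i (bdryPt x₀ + r • (θ : Euc (N + 1))) ^ 2 ∂sphereMeasure N := by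
  rw [almgrenH, halfSphereIntegral, ← mul_assoc, one_div, inv_mul_cancel₀ (pow_ne_zero N hr.ne'),
    one_mul]
  exact integral_finsetSum _ fun i _ => hv.integrableOn_sq_upperSphere i x₀ hr

lemma continuousOn_integral_halfBall (i : Fin k) (x₀ : Euc N) :
    ContinuousOn (fun r => ∫ X in halfBall N (bdryPt x₀) r, ‖gradient (v i) X‖ ^ 2) (Ioi 0) := by
  intro r (hr : 0 < r)
  have h2r : (0 : ℝ) ≤ 2 * r := by linarith
  have h1 := ((intervalIntegrable_halfSphereIntegral x₀ h2r
    (hv.integrableOn_norm_gradient_sq i (bdryPt x₀) (2 * r)))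
      |>.absolutelyContinuousOnInterval_intervalIntegral (c := 0) left_mem_uIcc).continuousOn
  rw [uIcc_of_le h2r] at h1
  refine ((h1.continuousAt (Icc_mem_nhds hr (by linarith))).congr ?_).continuousWithinAt
  filter_upwards [Ioi_mem_nhds hr] with s (hs : 0 < s)
  exact (integral_halfBall_eq x₀ hs.le (hv.integrableOn_norm_gradient_sq i _ s)).symm

lemma hasDerivAt_almgrenH (x₀ : Euc N) {r : ℝ} (hr : 0 < r) :
    HasDerivAt (almgrenH v x₀) (2 * halfBallEnergy v x₀ r / r ^ N) r := by
  have h1 : ∀ i, HasDerivAt (fun s => ∫ θ in upperSphere N,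
      v i (bdryPt x₀ + s • (θ : Euc (N + 1))) ^ 2 ∂sphereMeasure N)
      (2 * (∫ X in halfBall N (bdryPt x₀) r, ‖gradient (v i) X‖ ^ 2) / r ^ N) r := by
    intro i
    set g : ℝ → ℝ := fun ρ =>
      2 * (∫ X in halfBall N (bdryPt x₀) ρ, ‖gradient (v i) X‖ ^ 2) / ρ ^ N with hg
    have hgc : ContinuousOn g (Ioi 0) :=
      (continuousOn_const.mul (hv.continuousOn_integral_halfBall i x₀)).div (by fun_prop)
        fun s hs => pow_ne_zero _ (ne_of_gt hs)
    have hr2 : 0 < r / 2 := half_pos hr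
    have h2 : HasDerivAt (fun s => ∫ ρ in (r / 2)..s, g ρ) (g r) r := by
      refine intervalIntegral.integral_hasDerivAt_right ?_
        (hgc.stronglyMeasurableAtFilter isOpen_Ioi r hr) (hgc.continuousAt (Ioi_mem_nhds hr))
      refine (hgc.mono ?_).intervalIntegrable
      rw [uIcc_of_le (by linarith)]
      exact fun s hs => hr2.trans_le hs.1
    refine (h2.add_const (∫ θ in upperSphere N,
      v i (bdryPt x₀ + (r / 2) • (θ : Euc (N + 1))) ^ 2 ∂sphereMeasure N)).congr_of_eventuallyEq ?_
    filter_upwards [Ioi_mem_nhds (half_lt_self hr)] with s (hs : r / 2 < s)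
    rw [← hv.integral_sq_sub i x₀ hr2 hs.le]
    ring
  have h2 := HasDerivAt.fun_sum (u := Finset.univ) fun i _ => h1 i
  rw [hv.halfBallEnergy_eq_sum, Finset.mul_sum, Finset.sum_div]
  refine h2.congr_of_eventuallyEq ?_
  filter_upwards [Ioi_mem_nhds hr] with s hs
  exact hv.almgrenH_eq_sum x₀ hs

lemma ae_pohozaev (x₀ : Euc N) : ∀ᵐ r : ℝ, 0 < r →
    (1 - (N : ℝ)) * halfBallEnergy v x₀ r + r * halfSphereEnergy v x₀ r =
      2 * r * halfSphereRadialEnergy v x₀ r := by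
  have h1 := hv.pohozaev N 0 (add_zero N) (trivialSplitting N) (fun p => rfl) x₀
  have h2 := Measure.ae_ae_of_ae_prod h1
  filter_upwards [h2] with r hr hr0
  -- By Fubini, almost every `r` admits a good `l > 0`; one is enough because the identity does not
  -- depend on `l`.
  have h3 : ∃ l : ℝ, PohozaevOn (trivialSplitting N) v (bdryPt x₀) r l := by
    by_contra hcon
    push Not at hcon
    have h4 : ∀ᵐ l : ℝ, ¬ 0 < l := by
      filter_upwards [hr] with l hl hl0
      exact hcon l (hl hr0 hl0)
    rw [ae_iff] at h4
    simp only [not_not] at h4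
    change volume (Ioi (0 : ℝ)) = 0 at h4
    simp at h4
  obtain ⟨l, hl⟩ := h3
  have h5 := pohozaevOn_trivialSplitting hl (bdryPt_last x₀)
  simp_rw [← Finset.mul_sum] at h5
  rwa [integral_const_mul] at h5

lemma integrableOn_inner_sq (i : Fin k) (x₀ : Euc N) (r : ℝ) :
    IntegrableOn (fun X => inner ℝ (gradient (v i) X)
      (‖X - bdryPt x₀‖⁻¹ • (X - bdryPt x₀)) ^ 2) (halfBall N (bdryPt x₀) r) := by
  refine Integrable.mono (hv.integrableOn_norm_gradient_sq i (bdryPt x₀) r) ?_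
    (Filter.Eventually.of_forall fun X => ?_)
  · exact ((hv.memLp_gradient i (bdryPt x₀) r).aestronglyMeasurable.inner (𝕜 := ℝ)
      ((by fun_prop : Measurable fun X : Euc (N + 1) =>
        ‖X - bdryPt x₀‖⁻¹ • (X - bdryPt x₀)).aestronglyMeasurable)).pow 2
  · rw [norm_pow, norm_pow, norm_norm]
    gcongr
    refine (norm_inner_le_norm _ _).trans (mul_le_of_le_one_right (norm_nonneg _) ?_)
    rw [norm_smul, norm_inv, norm_norm]
    exact inv_mul_le_one

lemma ae_integrableOn_ray (i : Fin k) (x₀ : Euc N) : ∀ᵐ ρ : ℝ, 0 < ρ →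
    IntegrableOn (fun θ : Metric.sphere (0 : Euc (N + 1)) 1 =>
      inner ℝ (gradient (v i) (bdryPt x₀ + ρ • (θ : Euc (N + 1)))) (θ : Euc (N + 1)) ^ 2)
      (upperSphere N) (sphereMeasure N) ∧
    IntegrableOn (fun θ : Metric.sphere (0 : Euc (N + 1)) 1 =>
      v i (bdryPt x₀ + ρ • (θ : Euc (N + 1))) *
        inner ℝ (gradient (v i) (bdryPt x₀ + ρ • (θ : Euc (N + 1)))) (θ : Euc (N + 1)))
      (upperSphere N) (sphereMeasure N) := by
  filter_upwards [ae_integrableOn_upperSphere x₀ fun r _ => hv.integrableOn_inner_sq i x₀ r,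
    ae_integrableOn_upperSphere x₀ fun r _ => hv.integrableOn_mul_inner i x₀ r] with ρ h1 h2 hρ
  have h3 : ∀ θ : Metric.sphere (0 : Euc (N + 1)) 1,
      ‖bdryPt x₀ + ρ • (θ : Euc (N + 1)) - bdryPt x₀‖⁻¹ •
        (bdryPt x₀ + ρ • (θ : Euc (N + 1)) - bdryPt x₀) = (θ : Euc (N + 1)) := by
    intro θ
    have hθ : ‖(θ : Euc (N + 1))‖ = 1 := norm_eq_of_mem_sphere θ
    simp only [add_sub_cancel_left, norm_smul, hθ, mul_one, Real.norm_eq_abs,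
      abs_of_pos hρ, smul_smul, inv_mul_cancel₀ hρ.ne', one_smul]
  have h1' := h1 hρ
  have h2' := h2 hρ
  simp only [h3] at h1' h2'
  exact ⟨h1', h2'⟩

/-- The expansion of `∫ (∂_ν v - c v)²` over half spheres. -/
lemma ae_integral_radial_defect (x₀ : Euc N) : ∀ᵐ ρ : ℝ, 0 < ρ → ∀ c : ℝ,
    (∀ i, IntegrableOn (fun θ : Metric.sphere (0 : Euc (N + 1)) 1 =>
      (inner ℝ (gradient (v i) (bdryPt x₀ + ρ • (θ : Euc (N + 1)))) (θ : Euc (N + 1)) -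
        c * v i (bdryPt x₀ + ρ • (θ : Euc (N + 1)))) ^ 2) (upperSphere N) (sphereMeasure N)) ∧
    ρ ^ N * ∑ i, ∫ θ in upperSphere N,
      (inner ℝ (gradient (v i) (bdryPt x₀ + ρ • (θ : Euc (N + 1)))) (θ : Euc (N + 1)) -
        c * v i (bdryPt x₀ + ρ • (θ : Euc (N + 1)))) ^ 2 ∂sphereMeasure N =
      halfSphereRadialEnergy v x₀ ρ - 2 * c * halfBallEnergy v x₀ ρ +
        c ^ 2 * (ρ ^ N * almgrenH v x₀ ρ) := by
  have hi := ae_all_iff.2 fun i => hv.ae_integrableOn_ray i x₀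
  have hf := ae_all_iff.2 fun i => hv.ae_energy_eq_flux i x₀
  -- The exceptional set of radii is fixed before `c`, so that `c` may depend on `ρ`.
  filter_upwards [hi, hf] with ρ hi hf hρ c
  have i1 := fun i => (hi i hρ).1
  have i2 := fun i => (hi i hρ).2
  have i3 := fun i => hv.integrableOn_sq_upperSphere i x₀ hρ
  have e : ∀ i, ∀ θ : Metric.sphere (0 : Euc (N + 1)) 1,
      (inner ℝ (gradient (v i) (bdryPt x₀ + ρ • (θ : Euc (N + 1)))) (θ : Euc (N + 1)) -
        c * v i (bdryPt x₀ + ρ • (θ : Euc (N + 1)))) ^ 2 =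
      inner ℝ (gradient (v i) (bdryPt x₀ + ρ • (θ : Euc (N + 1)))) (θ : Euc (N + 1)) ^ 2 -
        2 * c * (v i (bdryPt x₀ + ρ • (θ : Euc (N + 1))) *
          inner ℝ (gradient (v i) (bdryPt x₀ + ρ • (θ : Euc (N + 1)))) (θ : Euc (N + 1))) +
        c ^ 2 * v i (bdryPt x₀ + ρ • (θ : Euc (N + 1))) ^ 2 := fun i θ => by ring
  have i12 : ∀ i, IntegrableOn (fun θ : Metric.sphere (0 : Euc (N + 1)) 1 =>
      inner ℝ (gradient (v i) (bdryPt x₀ + ρ • (θ : Euc (N + 1)))) (θ : Euc (N + 1)) ^ 2 -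
        2 * c * (v i (bdryPt x₀ + ρ • (θ : Euc (N + 1))) *
          inner ℝ (gradient (v i) (bdryPt x₀ + ρ • (θ : Euc (N + 1)))) (θ : Euc (N + 1))))
      (upperSphere N) (sphereMeasure N) := fun i => (i1 i).sub ((i2 i).const_mul (2 * c))
  refine ⟨fun i => ?_, ?_⟩
  · simp_rw [e]
    exact (i12 i).add ((i3 i).const_mul (c ^ 2))
  have hB : halfSphereRadialEnergy v x₀ ρ = ρ ^ N * ∑ i, ∫ θ in upperSphere N,
      inner ℝ (gradient (v i) (bdryPt x₀ + ρ • (θ : Euc (N + 1)))) (θ : Euc (N + 1)) ^ 2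
        ∂sphereMeasure N := by
    rw [halfSphereRadialEnergy, halfSphereIntegral, ← integral_finsetSum _ fun i _ => i1 i]
    simp only [smul_smul, inv_mul_cancel₀ hρ.ne', one_smul]
  have hA : halfBallEnergy v x₀ ρ = ρ ^ N * ∑ i, ∫ θ in upperSphere N,
      v i (bdryPt x₀ + ρ • (θ : Euc (N + 1))) *
        inner ℝ (gradient (v i) (bdryPt x₀ + ρ • (θ : Euc (N + 1)))) (θ : Euc (N + 1))
        ∂sphereMeasure N := by
    rw [hv.halfBallEnergy_eq_sum, Finset.mul_sum]
    refine Finset.sum_congr rfl fun i _ => ?_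
    rw [hf i hρ, halfSphereIntegral]
    simp only [smul_smul, inv_mul_cancel₀ hρ.ne', one_smul]
  have hI : ∀ i, ∫ θ in upperSphere N,
      (inner ℝ (gradient (v i) (bdryPt x₀ + ρ • (θ : Euc (N + 1)))) (θ : Euc (N + 1)) -
        c * v i (bdryPt x₀ + ρ • (θ : Euc (N + 1)))) ^ 2 ∂sphereMeasure N =
      (∫ θ in upperSphere N,
        inner ℝ (gradient (v i) (bdryPt x₀ + ρ • (θ : Euc (N + 1)))) (θ : Euc (N + 1)) ^ 2
          ∂sphereMeasure N) - 2 * c * (∫ θ in upperSphere N,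
        v i (bdryPt x₀ + ρ • (θ : Euc (N + 1))) *
          inner ℝ (gradient (v i) (bdryPt x₀ + ρ • (θ : Euc (N + 1)))) (θ : Euc (N + 1))
          ∂sphereMeasure N) + c ^ 2 * ∫ θ in upperSphere N,
        v i (bdryPt x₀ + ρ • (θ : Euc (N + 1))) ^ 2 ∂sphereMeasure N := by
    intro i
    simp_rw [e]
    rw [integral_add (i12 i) ((i3 i).const_mul (c ^ 2)),
      integral_sub (i1 i) ((i2 i).const_mul (2 * c)), integral_const_mul, integral_const_mul]
  simp_rw [hI]
  rw [Finset.sum_add_distrib, Finset.sum_sub_distrib, ← Finset.mul_sum, ← Finset.mul_sum, hB, hA,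
    hv.almgrenH_eq_sum x₀ hρ]
  ring

lemma almgrenData (x₀ : Euc N) :
    AlmgrenData N (halfBallEnergy v x₀) (halfSphereEnergy v x₀) (halfSphereRadialEnergy v x₀)
      (almgrenH v x₀) where
  intervalIntegrable r hr :=
    intervalIntegrable_halfSphereIntegral x₀ hr.le (hv.integrableOn_energy _ r)
  eq_integral r hr := integral_halfBall_eq x₀ hr.le (hv.integrableOn_energy _ r)
  energy_nonneg r _ := integral_nonneg fun X => Finset.sum_nonneg fun i _ => sq_nonneg _
  mass_nonneg r hr := by
    rw [hv.almgrenH_eq_sum x₀ hr]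
    exact Finset.sum_nonneg fun i _ => integral_nonneg fun θ => sq_nonneg _
  hasDerivAt_mass r hr := hv.hasDerivAt_almgrenH x₀ hr
  pohozaev := hv.ae_pohozaev x₀
  cauchySchwarz := by
    filter_upwards [hv.ae_integral_radial_defect x₀] with ρ h hρ
    -- The radial defect is a nonnegative quadratic polynomial in `c`; its discriminant gives
    -- Cauchy–Schwarz for all components at once.
    have h1 : ∀ c : ℝ, 0 ≤ (ρ ^ N * almgrenH v x₀ ρ) * (c * c) +
        (-2 * halfBallEnergy v x₀ ρ) * c + halfSphereRadialEnergy v x₀ ρ := by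
      intro c
      have h2 := (h hρ c).2
      have h3 : 0 ≤ ρ ^ N * ∑ i, ∫ θ in upperSphere N,
          (inner ℝ (gradient (v i) (bdryPt x₀ + ρ • (θ : Euc (N + 1)))) (θ : Euc (N + 1)) -
            c * v i (bdryPt x₀ + ρ • (θ : Euc (N + 1)))) ^ 2 ∂sphereMeasure N :=
        mul_nonneg (pow_nonneg hρ.le N)
          (Finset.sum_nonneg fun i _ => integral_nonneg fun θ => sq_nonneg _)
      linarith
    have h4 := discrim_le_zero h1
    rw [discrim] at h4
    nlinarith

end IsSegregationProfile

/-! ### Homogeneity and the main theorem -/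

/-- The equation makes `τ ^ (-γ) * g τ` constant. -/
lemma eq_rpow_mul_of_hasDerivAt {g : ℝ → ℝ} {γ a b : ℝ} (ha : 0 ≤ a)
    (hg : ∀ ρ ∈ Ioo a b, HasDerivAt g (γ / ρ * g ρ) ρ) {ρ s : ℝ} (hs : 0 < s)
    (hρ : ρ ∈ Ioo a b) (hsρ : s * ρ ∈ Ioo a b) : g (s * ρ) = s ^ γ * g ρ := by
  have h1 : ∀ τ ∈ Ioo a b, HasDerivAt (fun τ => τ ^ (-γ) * g τ) 0 τ := by
    intro τ hτ
    have hτ0 : 0 < τ := ha.trans_lt hτ.1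
    have h2 := (Real.hasDerivAt_rpow_const (p := -γ) (Or.inl hτ0.ne')).mul (hg τ hτ)
    convert! h2 using 1
    rw [Real.rpow_sub_one hτ0.ne']
    ring
  have h3 := isOpen_Ioo.is_const_of_deriv_eq_zero (isPreconnected_Ioo)
    (fun τ hτ => (h1 τ hτ).differentiableAt.differentiableWithinAt)
    (fun τ hτ => (h1 τ hτ).deriv) hsρ hρ
  have hρ0 : 0 < ρ := ha.trans_lt hρ.1
  have h4 : ρ ^ (-γ) ≠ 0 := (Real.rpow_pos_of_pos hρ0 _).ne'
  have h5 : s ^ γ * s ^ (-γ) = 1 := by rw [← Real.rpow_add hs, add_neg_cancel, Real.rpow_zero]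
  beta_reduce at h3
  rw [Real.mul_rpow hs.le hρ0.le] at h3
  refine mul_left_cancel₀ h4 ?_
  calc ρ ^ (-γ) * g (s * ρ) = s ^ γ * s ^ (-γ) * (ρ ^ (-γ) * g (s * ρ)) := by rw [h5, one_mul]
    _ = s ^ γ * (s ^ (-γ) * ρ ^ (-γ) * g (s * ρ)) := by ring
    _ = ρ ^ (-γ) * (s ^ γ * g ρ) := by rw [h3]; ring

/-- Matches the abstract frequency with `almgrenN`; `N ≥ 1` ensures that the truncated exponent `N -
1` is the true one. -/
lemma almgrenN_eq {N k : ℕ} (hN : 1 ≤ N) (v : Fin k → Euc (N + 1) → ℝ) (x₀ : Euc N) {r : ℝ}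
    (hr : 0 < r) :
    halfBallEnergy v x₀ r * r / (r ^ N * almgrenH v x₀ r) = almgrenN v x₀ r := by
  obtain ⟨M, rfl⟩ : ∃ M, N = M + 1 := ⟨N - 1, by omega⟩
  rw [almgrenN, almgrenE, ← halfBallEnergy, Nat.add_sub_cancel, pow_succ]
  have : r ^ M ≠ 0 := pow_ne_zero _ hr.ne'
  rw [mul_comm (r ^ M) r, mul_assoc r, mul_comm (halfBallEnergy v x₀ r) r,
    mul_div_mul_left _ _ hr.ne', one_div_mul_eq_div, div_div]

namespace IsSegregationProfile

variable {N k : ℕ} {v : Fin k → Euc (N + 1) → ℝ} (hv : IsSegregationProfile v)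
include hv

/-- An identity between continuous functions which holds in the open half space extends to the
closed one. -/
lemma homogeneous_closedUpperHalf (i : Fin k) (x₀ : Euc N) {t c : ℝ} (ht : 0 < t)
    (h : ∀ ξ ∈ upperHalf N, v i (bdryPt x₀ + t • ξ) = c * v i (bdryPt x₀ + ξ)) :
    ∀ ξ ∈ closedUpperHalf N, v i (bdryPt x₀ + t • ξ) = c * v i (bdryPt x₀ + ξ) := by
  have h1 : ∀ s : ℝ, 0 < s → ContinuousOn (fun ξ => v i (bdryPt x₀ + s • ξ)) (closedUpperHalf N) :=
    fun s hs => (hv.continuousOn i).comp (f := fun ξ => bdryPt x₀ + s • ξ) (by fun_prop)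
      fun ξ hξ => (bdryPt_add_mem_closedUpperHalf x₀).2 ((smul_mem_closedUpperHalf hs).2 hξ)
  have h2 := h1 1 one_pos
  simp only [one_smul] at h2
  exact EqOn.of_subset_closure h (h1 t ht) (continuousOn_const.mul h2)
    upperHalf_subset_closedUpperHalf closedUpperHalf_subset_closure

/-- If `H` vanished at every radius, continuity would make `v` zero on every open half sphere about
`x₀`, hence on the half space and its closure. -/
lemma exists_almgrenH_pos (hne : ∃ i, ∃ X ∈ closedUpperHalf N, v i X ≠ 0) (x₀ : Euc N) :
    ∃ r, 0 < r ∧ 0 < almgrenH v x₀ r := by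
  by_contra! hcon
  obtain ⟨i, X, hX, hne⟩ := hne
  have h1 : EqOn (v i) (fun _ => 0) (upperHalf N) := by
    intro Y hY
    have hξ : Y - bdryPt x₀ ∈ upperHalf N := by
      rw [← bdryPt_add_mem_upperHalf x₀, add_sub_cancel]
      exact hY
    set ξ := Y - bdryPt x₀ with hξdef
    have hξ0 : ξ ≠ 0 := by
      rintro h
      rw [h] at hξ
      exact lt_irrefl (0 : ℝ) hξ
    have hr : 0 < ‖ξ‖ := norm_pos_iff.2 hξ0
    have h2 : almgrenH v x₀ ‖ξ‖ = 0 :=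
      le_antisymm (hcon _ hr) ((hv.almgrenData x₀).mass_nonneg _ hr)
    rw [hv.almgrenH_eq_sum x₀ hr,
      Finset.sum_eq_zero_iff_of_nonneg fun i _ => integral_nonneg fun θ => sq_nonneg _] at h2
    have h3 := (setIntegral_eq_zero_iff_of_nonneg_ae
      (Filter.Eventually.of_forall fun θ => sq_nonneg _)
      (hv.integrableOn_sq_upperSphere i x₀ hr)).1 (h2 i (Finset.mem_univ i))
    have h4 := Measure.eqOn_open_of_ae_eq h3 isOpen_upperSphere
      ((hv.continuousOn_ray i x₀ hr).pow 2) continuousOn_const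
    have h5 : (⟨‖ξ‖⁻¹ • ξ, by simp [norm_smul, hr.ne']⟩ : Metric.sphere (0 : Euc (N + 1)) 1) ∈
        upperSphere N := (smul_mem_upperHalf (inv_pos.2 hr)).2 hξ
    have h6 := h4 h5
    simp only [smul_smul, mul_inv_cancel₀ hr.ne', one_smul, Pi.zero_apply] at h6
    rw [hξdef, add_sub_cancel] at h6
    exact pow_eq_zero_iff two_ne_zero |>.1 h6
  exact hne (EqOn.of_subset_closure h1 (hv.continuousOn i) continuousOn_const
    upperHalf_subset_closedUpperHalf closedUpperHalf_subset_closure hX)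

/-- If the frequency is constant on an interval, then the profile is homogeneous in the
corresponding half annulus. -/
lemma homogeneous_annulus {x₀ : Euc N} (hN : 1 ≤ N) (hH : ∀ r, 0 < r → 0 < almgrenH v x₀ r)
    {γ a b : ℝ} (ha : 0 ≤ a) (hγ : ∀ r ∈ Ioo a b, almgrenN v x₀ r = γ) (i : Fin k)
    {ξ : Euc (N + 1)} (hξ : ξ ∈ upperHalf N) {s : ℝ} (hs : 0 < s) (h1 : ‖ξ‖ ∈ Ioo a b)
    (h2 : s * ‖ξ‖ ∈ Ioo a b) : v i (bdryPt x₀ + s • ξ) = s ^ γ * v i (bdryPt x₀ + ξ) := by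
  have hγ' : ∀ r ∈ Ioo a b, halfBallEnergy v x₀ r * r / (r ^ N * almgrenH v x₀ r) = γ :=
    fun r hr => (almgrenN_eq hN v x₀ (ha.trans_lt hr.1)).trans (hγ r hr)
  have hr : 0 < ‖ξ‖ := ha.trans_lt h1.1
  set θ : Metric.sphere (0 : Euc (N + 1)) 1 := ⟨‖ξ‖⁻¹ • ξ, by simp [norm_smul, hr.ne']⟩ with hθ
  have hθm : θ ∈ upperSphere N := (smul_mem_upperHalf (inv_pos.2 hr)).2 hξ
  have hmem : ∀ {ρ : ℝ} {θ : Metric.sphere (0 : Euc (N + 1)) 1}, 0 < ρ → θ ∈ upperSphere N →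
      bdryPt x₀ + ρ • (θ : Euc (N + 1)) ∈ upperHalf N := fun hρ hθ =>
    (bdryPt_add_mem_upperHalf x₀).2 ((smul_mem_upperHalf hρ).2 hθ)
  have hae : ∀ᵐ ρ : ℝ, ρ ∈ Ioo a b →
      inner ℝ (gradient (v i) (bdryPt x₀ + ρ • (θ : Euc (N + 1)))) (θ : Euc (N + 1)) =
        γ / ρ * v i (bdryPt x₀ + ρ • (θ : Euc (N + 1))) := by
    filter_upwards [(hv.almgrenData x₀).ae_eq_of_frequency_const ha hH hγ',
      hv.ae_integral_radial_defect x₀] with ρ hB hdef hρ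
    have hρ0 : 0 < ρ := ha.trans_lt hρ.1
    have hHρ := hH ρ hρ0
    -- The choice `c = γ / ρ` is the minimizer of the quadratic. Equality in Cauchy–Schwarz makes
    -- the defect zero, so `∂_ρ v = (γ / ρ) v` almost everywhere on this half sphere, and everywhere
    -- by continuity.
    obtain ⟨hint, hsum⟩ := hdef hρ0 (γ / ρ)
    have hpow : 0 < ρ ^ N := pow_pos hρ0 N
    have hA : halfBallEnergy v x₀ ρ = γ / ρ * (ρ ^ N * almgrenH v x₀ ρ) := by
      rw [← hγ' ρ hρ]
      field_simp
    have hB' : halfSphereRadialEnergy v x₀ ρ = (γ / ρ) ^ 2 * (ρ ^ N * almgrenH v x₀ ρ) := by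
      refine mul_right_cancel₀ (mul_pos hpow hHρ).ne' ?_
      rw [hB hρ, hA]
      ring
    have hz : halfSphereRadialEnergy v x₀ ρ - 2 * (γ / ρ) * halfBallEnergy v x₀ ρ +
        (γ / ρ) ^ 2 * (ρ ^ N * almgrenH v x₀ ρ) = 0 := by
      rw [hB', hA]
      ring
    rw [hz, mul_eq_zero, or_iff_right hpow.ne',
      Finset.sum_eq_zero_iff_of_nonneg fun i _ => integral_nonneg fun θ => sq_nonneg _] at hsum
    have h3 := (setIntegral_eq_zero_iff_of_nonneg_ae
      (Filter.Eventually.of_forall fun θ => sq_nonneg _) (hint i)).1 (hsum i (Finset.mem_univ i))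
    have hc : ContinuousOn (fun θ : Metric.sphere (0 : Euc (N + 1)) 1 =>
        inner ℝ (gradient (v i) (bdryPt x₀ + ρ • (θ : Euc (N + 1)))) (θ : Euc (N + 1)))
        (upperSphere N) := by
      refine ContinuousOn.inner (𝕜 := ℝ) ((hv.continuousOn_grad i).comp (f := fun θ :
        Metric.sphere (0 : Euc (N + 1)) 1 => bdryPt x₀ + ρ • (θ : Euc (N + 1))) (by fun_prop)
        fun θ hθ => hmem hρ0 hθ) continuous_subtype_val.continuousOn
    have h4 := Measure.eqOn_open_of_ae_eq h3 isOpen_upperSphere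
      ((hc.sub (continuousOn_const.mul (hv.continuousOn_ray i x₀ hρ0))).pow 2)
      continuousOn_const hθm
    exact sub_eq_zero.1 (pow_eq_zero_iff two_ne_zero |>.1 h4)
  have hd : ∀ ρ ∈ Ioo a b, HasDerivAt (fun ρ => v i (bdryPt x₀ + ρ • (θ : Euc (N + 1))))
      (inner ℝ (gradient (v i) (bdryPt x₀ + ρ • (θ : Euc (N + 1)))) (θ : Euc (N + 1))) ρ :=
    fun ρ hρ => hv.hasDerivAt_ray i x₀ (ha.trans_lt hρ.1) hθm
  -- On the fixed ray both sides are continuous in `ρ`, so the equation holds at every radius in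
  -- `(a, b)` and can be integrated.
  have hall := Measure.eqOn_open_of_ae_eq (μ := volume)
    ((ae_restrict_iff' measurableSet_Ioo).2 hae) isOpen_Ioo
    (ContinuousOn.inner (𝕜 := ℝ) ((hv.continuousOn_grad i).comp (f := fun ρ : ℝ =>
        bdryPt x₀ + ρ • (θ : Euc (N + 1))) (by fun_prop)
        fun ρ (hρ : ρ ∈ Ioo a b) => hmem (ha.trans_lt hρ.1) hθm) continuousOn_const)
    ((continuousOn_const.div continuousOn_id fun ρ hρ => (ha.trans_lt hρ.1).ne').mul
      fun ρ hρ => (hd ρ hρ).continuousAt.continuousWithinAt)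
  have h5 := eq_rpow_mul_of_hasDerivAt ha (fun ρ hρ => (hd ρ hρ).congr_deriv (hall hρ)) hs h1 h2
  simpa only [hθ, smul_smul, mul_assoc, mul_inv_cancel₀ hr.ne', mul_one, one_smul] using h5

lemma homogeneous {x₀ : Euc N} (hN : 1 ≤ N) (hH : ∀ r, 0 < r → 0 < almgrenH v x₀ r)
    {γ a b : ℝ} (ha : 0 ≤ a) (hab : a < b) (hγ : ∀ r ∈ Ioo a b, almgrenN v x₀ r = γ)
    (i : Fin k) {ξ : Euc (N + 1)} (hξ : ξ ∈ closedUpperHalf N) {t : ℝ} (ht : 0 < t) :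
    v i (bdryPt x₀ + t • ξ) = t ^ γ * v i (bdryPt x₀ + ξ) := by
  obtain ⟨c, hac, hcb⟩ := exists_between hab
  have hc : 0 < c := ha.trans_lt hac
  have hpre : ∀ s : ℝ, 0 < s → IsWeaklyHarmonicOn (fun ξ => v i (bdryPt x₀ + s • ξ))
      (upperHalf N) := fun s hs =>
    ((hv.isWeaklyHarmonicOn i).comp_add_smul isOpen_upperHalf (bdryPt x₀) hs.ne').mono
      fun ξ hξ => (bdryPt_add_mem_upperHalf x₀).2 ((smul_mem_upperHalf hs).2 hξ)
  -- For `a < ‖ξ‖ < c` and `1 ≤ s < b / c` both `ξ` and `s • ξ` lie in the annulus. There `v(s ·) -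
  -- s^γ v` vanishes, and unique continuation spreads this to the whole half space.
  have small : ∀ s : ℝ, 1 ≤ s → s < b / c → ∀ ξ ∈ upperHalf N,
      v i (bdryPt x₀ + s • ξ) = s ^ γ * v i (bdryPt x₀ + ξ) := by
    intro s hs1 hsb ξ hξ
    have hs : 0 < s := one_pos.trans_le hs1
    have h1 := (hpre s hs).sub_const_mul isOpen_upperHalf (hpre 1 one_pos) (s ^ γ)
    have hO : IsOpen (upperHalf N ∩ (fun ξ : Euc (N + 1) => ‖ξ‖) ⁻¹' Ioo a c) :=
      isOpen_upperHalf.inter (isOpen_Ioo.preimage continuous_norm)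
    have hne : (upperHalf N ∩
        (upperHalf N ∩ (fun ξ : Euc (N + 1) => ‖ξ‖) ⁻¹' Ioo a c)).Nonempty := by
      obtain ⟨d, hd1, hd2⟩ := exists_between hac
      have hd : 0 < d := ha.trans_lt hd1
      have : EuclideanSpace.single (Fin.last N) d ∈ upperHalf N := by simpa [upperHalf] using hd
      refine ⟨EuclideanSpace.single (Fin.last N) d, this, this, ?_⟩
      simp [abs_of_pos hd, hd1, hd2]
    have h2 := h1.eqOn_zero_of_isPreconnected isOpen_upperHalf isPreconnected_upperHalf hO hne
      (fun ξ hξ => by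
        have hξa : a < ‖ξ‖ := hξ.2.1
        have hξc : ‖ξ‖ < c := hξ.2.2
        have hn : 0 < ‖ξ‖ := ha.trans_lt hξa
        rw [one_smul, sub_eq_zero]
        refine hv.homogeneous_annulus hN hH ha hγ i hξ.1 hs ⟨hξa, hξc.trans hcb⟩ ⟨?_, ?_⟩
        · nlinarith
        · rw [lt_div_iff₀ hc] at hsb
          nlinarith) ξ hξ
    rwa [one_smul, sub_eq_zero] at h2
  have iter : ∀ s : ℝ, 1 ≤ s → s < b / c → ∀ n : ℕ, ∀ ξ ∈ upperHalf N,
      v i (bdryPt x₀ + s ^ n • ξ) = (s ^ n) ^ γ * v i (bdryPt x₀ + ξ) := by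
    intro s hs1 hsb n
    have hs : 0 < s := one_pos.trans_le hs1
    induction n with
    | zero => intro ξ _; simp
    | succ n ih =>
      intro ξ hξ
      rw [pow_succ, ← smul_smul, ih _ ((smul_mem_upperHalf hs).2 hξ), small s hs1 hsb ξ hξ,
        Real.mul_rpow (pow_nonneg hs.le n) hs.le, mul_assoc]
  have large : ∀ t : ℝ, 1 ≤ t → ∀ ξ ∈ upperHalf N,
      v i (bdryPt x₀ + t • ξ) = t ^ γ * v i (bdryPt x₀ + ξ) := by
    intro t ht1
    have ht : 0 < t := one_pos.trans_le ht1
    have h1 : 1 < b / c := (one_lt_div hc).2 hcb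
    -- With `t < (b / c) ^ n` the `n`-th root of `t` is a small dilation, and `t` is its `n`-th
    -- iterate.
    obtain ⟨n, hn⟩ := pow_unbounded_of_one_lt t h1
    have hn0 : n ≠ 0 := by
      rintro rfl
      rw [pow_zero] at hn
      linarith
    have hp := Real.rpow_inv_natCast_pow ht.le hn0
    have h2 := iter (t ^ ((n : ℝ)⁻¹)) (Real.one_le_rpow ht1 (by positivity))
      (lt_of_pow_lt_pow_left₀ n (by positivity) (by rwa [hp])) n
    rwa [hp] at h2
  refine hv.homogeneous_closedUpperHalf i x₀ ht (fun ξ hξ => ?_) ξ hξ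
  rcases le_total 1 t with h | h
  · exact large t h ξ hξ
  · have h1 := large t⁻¹ ((one_le_inv₀ ht).2 h) (t • ξ) ((smul_mem_upperHalf ht).2 hξ)
    rw [smul_smul, inv_mul_cancel₀ ht.ne', one_smul, Real.inv_rpow ht.le] at h1
    rw [h1, mul_inv_cancel_left₀ (Real.rpow_pos_of_pos ht γ).ne']

end IsSegregationProfile

theorem mainTheorem9 {N k : ℕ} (hN : 1 ≤ N) (v : Fin k → Euc (N + 1) → ℝ)
    (hv : IsSegregationProfile v) (hne : ∃ i, ∃ X ∈ closedUpperHalf N, v i X ≠ 0)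
    (x₀ : Euc N) :
    -- the frequency is well defined
    (∀ r : ℝ, 0 < r →
      IntegrableOn (fun X => ∑ i, ‖gradient (v i) X‖ ^ 2) (halfBall N (bdryPt x₀) r) ∧
        0 < almgrenH v x₀ r) ∧
    -- (locally) absolutely continuous and nondecreasing on `(0, ∞)`
    (∀ a b : ℝ, 0 < a → a ≤ b → AbsolutelyContinuousOnInterval (almgrenN v x₀) a b) ∧
    MonotoneOn (almgrenN v x₀) (Ioi 0) ∧
    -- the logarithmic derivative of `H`
    (∀ r : ℝ, 0 < r →
      HasDerivAt (fun s => Real.log (almgrenH v x₀ s)) (2 * almgrenN v x₀ r / r) r) ∧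
    -- rigidity
    (∀ γ a b : ℝ, 0 ≤ a → a < b → (∀ r ∈ Ioo a b, almgrenN v x₀ r = γ) →
      (∀ r : ℝ, 0 < r → almgrenN v x₀ r = γ) ∧
      ∀ i, ∀ ξ ∈ closedUpperHalf N, ∀ t : ℝ, 0 < t →
        v i (bdryPt x₀ + t • ξ) = t ^ γ * v i (bdryPt x₀ + ξ)) := by
  have D := hv.almgrenData x₀
  have hH : ∀ r, 0 < r → 0 < almgrenH v x₀ r := by
    obtain ⟨R, hR, hHR⟩ := hv.exists_almgrenH_pos hne x₀
    exact fun r hr => D.mass_pos hR hHR hr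
  have hlog : ∀ r : ℝ, 0 < r →
      HasDerivAt (fun s => Real.log (almgrenH v x₀ s)) (2 * almgrenN v x₀ r / r) r := by
    intro r hr
    rw [← almgrenN_eq hN v x₀ hr]
    exact D.hasDerivAt_log_mass hr (hH r hr)
  refine ⟨fun r hr => ⟨hv.integrableOn_energy _ r, hH r hr⟩, fun a b ha hab => ?_, ?_, hlog, ?_⟩
  · refine (D.absolutelyContinuous_frequency ha hab (hH a ha)).congr fun r hr => ?_
    rw [uIcc_of_le hab] at hr
    exact almgrenN_eq hN v x₀ (ha.trans_le hr.1)
  · intro r hr s hs hrs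
    rw [← almgrenN_eq hN v x₀ hr, ← almgrenN_eq hN v x₀ hs]
    exact D.frequency_le hr hrs (hH r hr)
  · intro γ a b ha hab hγ
    have hom := fun (i : Fin k) (ξ : Euc (N + 1)) (hξ : ξ ∈ closedUpperHalf N) (t : ℝ)
      (ht : 0 < t) => hv.homogeneous hN hH ha hab hγ i hξ ht
    refine ⟨fun r hr => ?_, hom⟩
    -- Homogeneity gives `H s = s^{2γ} H 1`, so `log H` has derivative `2γ / r`; comparing with `2
    -- N(r) / r` identifies the frequency at every radius.
    have h1 : ∀ s : ℝ, 0 < s →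
        Real.log (almgrenH v x₀ s) = 2 * (γ * Real.log s) + Real.log (almgrenH v x₀ 1) := by
      intro s hs
      have h2 : almgrenH v x₀ s = (s ^ γ) ^ 2 * almgrenH v x₀ 1 := by
        rw [hv.almgrenH_eq_sum x₀ hs, hv.almgrenH_eq_sum x₀ one_pos, Finset.mul_sum]
        refine Finset.sum_congr rfl fun i _ => ?_
        rw [← integral_const_mul]
        refine setIntegral_congr_fun isOpen_upperSphere.measurableSet fun θ hθ => ?_
        simp only [one_smul, hom i _ (upperHalf_subset_closedUpperHalf hθ) s hs, mul_pow]
      have h3 : 0 < s ^ γ := Real.rpow_pos_of_pos hs γ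
      rw [h2, Real.log_mul (pow_pos h3 2).ne' (hH 1 one_pos).ne', Real.log_pow,
        Real.log_rpow hs, Nat.cast_two]
    have h4 : HasDerivAt (fun s => Real.log (almgrenH v x₀ s)) (2 * (γ * r⁻¹)) r := by
      refine ((((Real.hasDerivAt_log hr.ne').const_mul γ).const_mul 2).add_const
        (Real.log (almgrenH v x₀ 1))).congr_of_eventuallyEq ?_
      filter_upwards [Ioi_mem_nhds hr] with s hs
      exact h1 s hs
    have h5 := (hlog r hr).unique h4
    field_simp at h5
    linarith

end
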